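/- Theorem 4.1 (A coupling inequality for maxima of sums of random vectors). There is a universal constant $C>0$ such that the following holds. Let $n\ge 0$ and $p\ge 1$ be integers and let $X_1,\dots,X_n$ be independent random vectors in $\mathbb{R}^p$, defined on a probability space $(\Omega,\mathcal{A},\mathbb{P})$, with mean zero and finite absolute third moments, that is, $\mathbb{E}[X_{ij}]=0$ and $\mathbb{E}[|X_{ij}|^3]<\infty$ for all $1\le i\le n$, $1\le j\le p$. Assume that there is a random variable on $(\Omega,\mathcal{A},\mathbb{P})$ that is uniformly distributed on $(0,1)$ and independent of $(X_1,\dots,X_n)$. Let $Z=\max_{1\le j\le p}\sum_{i=1}^n X_{ij}$, and let $Y_1,\dots,Y_n$ be independent random vectors in $\mathbb{R}^p$ (possibly defined on another probability space) with $Y_i\sim N(0,\mathbb{E}[X_iX_i^T])$ for $1\le i\le n$. Then for every $\beta>0$ and $\delta>1/\beta$ there exists a random variable $\widetilde Z$ on $(\Omega,\mathcal{A},\mathbb{P})$ with the same distribution as $\max_{1\le j\le p}\sum_{i=1}^n Y_{ij}$ such that $$\mathbb{P}\left(|Z-\widetilde Z|>2\beta^{-1}\log p+3\delta\right)\le\frac{\varepsilon+C\beta\delta^{-1}\{B_1+\beta(B_2+B_3)\}}{1-\varepsilon},$$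 where $$\varepsilon=\varepsilon_{\beta,\delta}=\sqrt{e^{-\alpha}(1+\alpha)}<1,\qquad \alpha=\beta^2\delta^2-1>0,$$ and $$B_1=\mathbb{E}\left[\max_{1\le j,k\le p}\left|\sum_{i=1}^n\left(X_{ij}X_{ik}-\mathbb{E}[X_{ij}X_{ik}]\right)\right|\right],\qquad B_2=\mathbb{E}\left[\max_{1\le j\le p}\sum_{i=1}^n|X_{ij}|^3\right],$$ $$B_3=\sum_{i=1}^n\mathbb{E}\left[\max_{1\le j\le p}|X_{ij}|^3\cdot 1\left(\max_{1\le j\le p}|X_{ij}|>\beta^{-1}/2\right)\right].$$ -/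

import Mathlib

open MeasureTheory ProbabilityTheory

namespace MaxCoupling

noncomputable section

/-- The maximum of a finite non-empty family of real numbers. -/
def vecMax {ι : Type*} [Fintype ι] [Nonempty ι] (x : ι → ℝ) : ℝ :=
  Finset.univ.sup' Finset.univ_nonempty x

/-- The second moment matrix `E[ξ ξᵀ]` of a random vector `ξ` in `ℝ^p`. -/
def secondMoment {Ω : Type*} [MeasurableSpace Ω] (P : Measure Ω) {p : ℕ}
    (ξ : Ω → EuclideanSpace ℝ (Fin p)) : Matrix (Fin p) (Fin p) ℝ :=
  Matrix.of fun j k => ∫ ω, ξ ω j * ξ ω k ∂P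

/-- The maximal coordinate of a sum of vectors: `max_j ∑_i X_{ij}`. -/
def maxSum {Ω : Type*} {n p : ℕ} [NeZero p]
    (X : Fin n → Ω → EuclideanSpace ℝ (Fin p)) (ω : Ω) : ℝ :=
  vecMax fun j : Fin p => ∑ i, X i ω j

/-- `α = β² δ² - 1`. -/
def alpha (β δ : ℝ) : ℝ := β ^ 2 * δ ^ 2 - 1

/-- `ε = √(e^{-α} (1 + α))`. -/
def eps (β δ : ℝ) : ℝ := Real.sqrt (Real.exp (-alpha β δ) * (1 + alpha β δ))

/-- `B₁ = E[max_{j,k} |∑_i (X_{ij} X_{ik} - E[X_{ij} X_{ik}])|]`. -/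
def B1 {Ω : Type*} [MeasurableSpace Ω] (P : Measure Ω) {n p : ℕ} [NeZero p]
    (X : Fin n → Ω → EuclideanSpace ℝ (Fin p)) : ℝ :=
  ∫ ω, vecMax (fun jk : Fin p × Fin p =>
    |∑ i, (X i ω jk.1 * X i ω jk.2 - ∫ ω', X i ω' jk.1 * X i ω' jk.2 ∂P)|) ∂P

/-- `B₂ = E[max_j ∑_i |X_{ij}|³]`. -/
def B2 {Ω : Type*} [MeasurableSpace Ω] (P : Measure Ω) {n p : ℕ} [NeZero p]
    (X : Fin n → Ω → EuclideanSpace ℝ (Fin p)) : ℝ :=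
  ∫ ω, vecMax (fun j : Fin p => ∑ i, |X i ω j| ^ 3) ∂P

/-- `B₃ = ∑_i E[max_j |X_{ij}|³ · 1(max_j |X_{ij}| > β⁻¹ / 2)]`. -/
def B3 {Ω : Type*} [MeasurableSpace Ω] (P : Measure Ω) {n p : ℕ} [NeZero p]
    (X : Fin n → Ω → EuclideanSpace ℝ (Fin p)) (β : ℝ) : ℝ :=
  ∑ i, ∫ ω, Set.indicator {ω' | vecMax (fun j : Fin p => |X i ω' j|) > β⁻¹ / 2}
    (fun ω' => vecMax (fun j : Fin p => |X i ω' j| ^ 3)) ω ∂P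

end

end MaxCoupling

/-! By Strassen's theorem a coupling of `Z` with the law `ν` of the Gaussian maximum exists once P(Z
∈ B) ≤ ν(B^r) + Δ holds for every Borel set B, where B^r is any measurable enlargement of B by r.
The proof has an analytic half, which establishes this inequality, and a constructive half, which
turns it into a random variable on the given space.

Analytic half. The maximum is replaced by the soft maximum `lse`, at a cost of β⁻¹ log p on each
side, and the indicator of B by a function g with three bounded derivatives that is exactly 1 near B
and exactly 0 far from B (`exists_testFun_indicator`). The expectations of g ∘ lse are compared
along the path cos θ · Y + sin θ · S, where S is the sum and Y an independent Gaussian vector with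
the same covariance (`abs_integral_sub_integral_le`). The Gaussian part of the θ-derivative is
rewritten by integration by parts (`integral_coord_mul_eq`), the other part by Stein's leave-one-out
argument (`abs_integral_grad_sub_hess_le`). What remains is a covariance fluctuation, giving B₁, and
a third-order Taylor remainder, giving B₂ and B₃. No dimension factor appears, because the
derivatives of `lse` are built from Gibbs weights, which sum to one.

Constructive half. Strassen's theorem is proved on a finite set from Hall's marriage theorem
(`exists_transport`), realized with the uniform variable (`exists_randomization`), and transferred
to the line through a fine grid (`exists_coupling`). This loses an arbitrarily small distance 2d and
probability η.

The losses fit into the slack of the statement. Since g has an exact plateau and exact vanishing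
set, the enlargement needed is only r = 2β⁻¹ log p + 2β⁻¹ + δ, which leaves 2(δ - β⁻¹) > 0 for the
distance; the probability loss η is taken to be ε. Of ε only 0 < ε < 1 matters. -/

namespace MaxCoupling

/-! ### Smoothing the indicator of a set of reals by iterated averaging -/

/-- A three times differentiable function on the line with bounded derivatives, the bounds being
those of a smoothing of an `L`-Lipschitz function at scale `β⁻¹`. -/
structure TestFun (L β : ℝ) where
  toFun : ℝ → ℝ
  d1 : ℝ → ℝ
  d2 : ℝ → ℝ
  d3 : ℝ → ℝ
  hasDerivAt : ∀ x, HasDerivAt toFun (d1 x) x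
  hasDerivAt_d1 : ∀ x, HasDerivAt d1 (d2 x) x
  hasDerivAt_d2 : ∀ x, HasDerivAt d2 (d3 x) x
  nonneg : ∀ x, 0 ≤ toFun x
  le_one : ∀ x, toFun x ≤ 1
  abs_d1_le : ∀ x, |d1 x| ≤ L
  abs_d2_le : ∀ x, |d2 x| ≤ 3 * L * β
  abs_d3_le : ∀ x, |d3 x| ≤ 9 * L * β ^ 2

section SymmAvg

variable {a : ℝ} {u : ℝ → ℝ}

/-- Average of `u` over the interval of radius `a` around `x`. -/
noncomputable def symmAvg (a : ℝ) (u : ℝ → ℝ) (x : ℝ) : ℝ :=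
  (2 * a)⁻¹ * ∫ t in (x - a)..(x + a), u t

/-- Symmetric difference quotient of `u` at `x` with step `a`. -/
noncomputable def symmQuot (a : ℝ) (u : ℝ → ℝ) (x : ℝ) : ℝ :=
  (2 * a)⁻¹ * (u (x + a) - u (x - a))

/-- Each average gains one derivative and turns it into a difference quotient. A quotient of an
L-Lipschitz function is bounded by L; every further quotient costs a factor 1/a. Three averages
therefore give three derivatives, of sizes L, L/a and L/a². -/
lemma hasDerivAt_symmAvg (hu : Continuous u) (x : ℝ) :
    HasDerivAt (symmAvg a u) (symmQuot a u x) x := by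
  have hF : ∀ y, HasDerivAt (fun y => ∫ t in (0 : ℝ)..y, u t) (u y) y := fun y =>
    intervalIntegral.integral_hasDerivAt_right (hu.intervalIntegrable _ _)
      hu.aestronglyMeasurable.stronglyMeasurableAtFilter hu.continuousAt
  have h1 := (hF (x + a)).comp x ((hasDerivAt_id x).add_const a)
  have h2 := (hF (x - a)).comp x ((hasDerivAt_id x).sub_const a)
  have h3 := (h1.sub h2).const_mul (2 * a)⁻¹
  have he : symmAvg a u = fun y => (2 * a)⁻¹ * (((fun y => ∫ t in (0 : ℝ)..y, u t) ∘
      (fun y => id y + a)) y - ((fun y => ∫ t in (0 : ℝ)..y, u t) ∘ (fun y => id y - a)) y) := by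
    funext y
    simp only [symmAvg, Function.comp, id]
    rw [intervalIntegral.integral_interval_sub_left (hu.intervalIntegrable _ _)
      (hu.intervalIntegrable _ _)]
  rw [he]
  exact h3.congr_deriv (by simp [symmQuot])

lemma continuous_symmAvg (hu : Continuous u) : Continuous (symmAvg a u) :=
  continuous_iff_continuousAt.2 fun x => (hasDerivAt_symmAvg hu x).continuousAt

lemma hasDerivAt_symmQuot {u' : ℝ → ℝ} (hu : ∀ x, HasDerivAt u (u' x) x) (x : ℝ) :
    HasDerivAt (symmQuot a u) (symmQuot a u' x) x := by
  have h1 := (hu (x + a)).comp x ((hasDerivAt_id x).add_const a)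
  have h2 := (hu (x - a)).comp x ((hasDerivAt_id x).sub_const a)
  exact ((h1.sub h2).const_mul (2 * a)⁻¹).congr_deriv (by simp [symmQuot])

lemma abs_symmQuot_le_of_bounded (ha : 0 < a) {M : ℝ} (hu : ∀ x, |u x| ≤ M) (x : ℝ) :
    |symmQuot a u x| ≤ M / a := by
  rw [symmQuot, abs_mul, abs_of_pos (by positivity : 0 < (2 * a)⁻¹)]
  have h := abs_sub (u (x + a)) (u (x - a))
  have h1 := hu (x + a)
  have h2 := hu (x - a)
  calc (2 * a)⁻¹ * |u (x + a) - u (x - a)| ≤ (2 * a)⁻¹ * (2 * M) := by gcongr; linarith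
    _ = M / a := by field_simp

lemma abs_symmQuot_le_of_lipschitz (ha : 0 < a) {L : ℝ}
    (hu : ∀ x y, |u x - u y| ≤ L * |x - y|) (x : ℝ) : |symmQuot a u x| ≤ L := by
  rw [symmQuot, abs_mul, abs_of_pos (by positivity : 0 < (2 * a)⁻¹)]
  have h := hu (x + a) (x - a)
  rw [show x + a - (x - a) = 2 * a by ring, abs_of_pos (by positivity : 0 < 2 * a)] at h
  calc (2 * a)⁻¹ * |u (x + a) - u (x - a)| ≤ (2 * a)⁻¹ * (L * (2 * a)) := by gcongr
    _ = L := by field_simp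

lemma symmAvg_lipschitz (ha : 0 < a) {L : ℝ} (hc : Continuous u)
    (hu : ∀ x y, |u x - u y| ≤ L * |x - y|) (x y : ℝ) :
    |symmAvg a u x - symmAvg a u y| ≤ L * |x - y| := by
  have := Convex.norm_image_sub_le_of_norm_hasDerivWithin_le (s := Set.univ) (f := symmAvg a u)
    (f' := symmQuot a u) (C := L) (x := y) (y := x)
    (fun z _ => (hasDerivAt_symmAvg hc z).hasDerivWithinAt)
    (fun z _ => abs_symmQuot_le_of_lipschitz ha hu z) convex_univ trivial trivial
  simpa using this

lemma symmAvg_le (ha : 0 < a) (hc : Continuous u) {c x : ℝ}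
    (h : ∀ t ∈ Set.Icc (x - a) (x + a), u t ≤ c) : symmAvg a u x ≤ c := by
  have h1 : ∫ t in (x - a)..(x + a), u t ≤ ∫ _ in (x - a)..(x + a), c :=
    intervalIntegral.integral_mono_on (by linarith) (hc.intervalIntegrable _ _)
      (by simp) h
  rw [intervalIntegral.integral_const, smul_eq_mul, show x + a - (x - a) = 2 * a by ring] at h1
  calc symmAvg a u x ≤ (2 * a)⁻¹ * (2 * a * c) := by unfold symmAvg; gcongr
    _ = c := by field_simp

lemma le_symmAvg (ha : 0 < a) (hc : Continuous u) {c x : ℝ}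
    (h : ∀ t ∈ Set.Icc (x - a) (x + a), c ≤ u t) : c ≤ symmAvg a u x := by
  have h1 : ∫ _ in (x - a)..(x + a), c ≤ ∫ t in (x - a)..(x + a), u t :=
    intervalIntegral.integral_mono_on (by linarith) (by simp)
      (hc.intervalIntegrable _ _) h
  rw [intervalIntegral.integral_const, smul_eq_mul, show x + a - (x - a) = 2 * a by ring] at h1
  calc c = (2 * a)⁻¹ * (2 * a * c) := by field_simp
    _ ≤ symmAvg a u x := by unfold symmAvg; gcongr

lemma symmAvg_symmAvg_symmAvg_le (ha : 0 < a) (hc : Continuous u) {c x : ℝ}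
    (h : ∀ t, |t - x| ≤ 3 * a → u t ≤ c) : symmAvg a (symmAvg a (symmAvg a u)) x ≤ c := by
  refine symmAvg_le ha (continuous_symmAvg (continuous_symmAvg hc)) fun t ht => ?_
  refine symmAvg_le ha (continuous_symmAvg hc) fun s hs => ?_
  refine symmAvg_le ha hc fun r hr => h r ?_
  rw [Set.mem_Icc] at ht hs hr
  rw [abs_le]
  constructor <;> linarith

lemma le_symmAvg_symmAvg_symmAvg (ha : 0 < a) (hc : Continuous u) {c x : ℝ}
    (h : ∀ t, |t - x| ≤ 3 * a → c ≤ u t) : c ≤ symmAvg a (symmAvg a (symmAvg a u)) x := by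
  refine le_symmAvg ha (continuous_symmAvg (continuous_symmAvg hc)) fun t ht => ?_
  refine le_symmAvg ha (continuous_symmAvg hc) fun s hs => ?_
  refine le_symmAvg ha hc fun r hr => h r ?_
  rw [Set.mem_Icc] at ht hs hr
  rw [abs_le]
  constructor <;> linarith

end SymmAvg

lemma abs_infDist_sub_infDist_le (B : Set ℝ) (x y : ℝ) :
    |Metric.infDist x B - Metric.infDist y B| ≤ |x - y| := by
  have := (Metric.lipschitz_infDist_pt B).dist_le_mul x y
  simpa [Real.dist_eq] using this

lemma abs_max_zero_sub_le (x y : ℝ) : |max 0 x - max 0 y| ≤ |x - y| := by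
  rw [max_comm 0 x, max_comm 0 y]
  exact abs_max_sub_max_le_abs x y 0

/-- Smooth approximation of the indicator function of a set `B` of reals: the function is `1` on
the `e`-neighbourhood and vanishes off the `(e + 2β⁻¹ + δ)`-neighbourhood. -/
theorem exists_testFun_indicator (B : Set ℝ) {e β δ : ℝ} (hβ : 0 < β) (hδ : 0 < δ) :
    ∃ g : TestFun δ⁻¹ β, (∀ x, Metric.infDist x B ≤ e → g.toFun x = 1) ∧
      ∀ x, e + 2 * β⁻¹ + δ ≤ Metric.infDist x B → g.toFun x = 0 := by
  -- A trapezoid with slope δ⁻¹ whose plateau reaches β⁻¹ too far, so that the averaging still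
  -- leaves the value 1 on the `e`-neighbourhood.
  set h : ℝ → ℝ := fun t => max 0 (1 - δ⁻¹ * max 0 (Metric.infDist t B - (e + β⁻¹))) with hh
  have hβ' : 0 < β⁻¹ := inv_pos.2 hβ
  have hδ' : 0 < δ⁻¹ := inv_pos.2 hδ
  have hc : Continuous h := by
    have := Metric.continuous_infDist_pt B
    fun_prop
  have hlip : ∀ x y, |h x - h y| ≤ δ⁻¹ * |x - y| := by
    intro x y
    calc |h x - h y| ≤ |(1 - δ⁻¹ * max 0 (Metric.infDist x B - (e + β⁻¹))) -
          (1 - δ⁻¹ * max 0 (Metric.infDist y B - (e + β⁻¹)))| :=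
          abs_max_zero_sub_le _ _
      _ = δ⁻¹ * |max 0 (Metric.infDist x B - (e + β⁻¹)) -
            max 0 (Metric.infDist y B - (e + β⁻¹))| := by
          rw [sub_sub_sub_cancel_left, ← mul_sub, abs_mul, abs_of_pos hδ', abs_sub_comm]
      _ ≤ δ⁻¹ * |(Metric.infDist x B - (e + β⁻¹)) - (Metric.infDist y B - (e + β⁻¹))| := by
          exact mul_le_mul_of_nonneg_left (abs_max_zero_sub_le _ _) hδ'.le
      _ ≤ δ⁻¹ * |x - y| := by
          refine mul_le_mul_of_nonneg_left ?_ hδ'.le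
          rw [sub_sub_sub_cancel_right]
          exact abs_infDist_sub_infDist_le B x y
  have h0 : ∀ x, 0 ≤ h x := fun x => le_max_left _ _
  have h1 : ∀ x, h x ≤ 1 := fun x => by
    refine max_le zero_le_one ?_
    have : 0 ≤ δ⁻¹ * max 0 (Metric.infDist x B - (e + β⁻¹)) := by positivity
    linarith
  -- Three averages of radius β⁻¹/3 look at distance at most β⁻¹ in total, and 1/a = 3β produces the
  -- constants 3 and 9 of `TestFun`.
  set a : ℝ := β⁻¹ / 3 with ha'
  have ha : 0 < a := by positivity
  have h3a : 3 * a = β⁻¹ := by rw [ha']; ring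
  have hinv : ∀ c : ℝ, c / a = 3 * c * β := fun c => by rw [ha']; field_simp
  have hc1 := continuous_symmAvg (a := a) hc
  have hc2 := continuous_symmAvg (a := a) hc1
  have hl1 := symmAvg_lipschitz ha hc hlip
  have hl2 := symmAvg_lipschitz ha hc1 hl1
  refine ⟨{ toFun := symmAvg a (symmAvg a (symmAvg a h))
            d1 := symmQuot a (symmAvg a (symmAvg a h))
            d2 := symmQuot a (symmQuot a (symmAvg a h))
            d3 := symmQuot a (symmQuot a (symmQuot a h))
            hasDerivAt := hasDerivAt_symmAvg hc2
            hasDerivAt_d1 := hasDerivAt_symmQuot (hasDerivAt_symmAvg hc1)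
            hasDerivAt_d2 := hasDerivAt_symmQuot (hasDerivAt_symmQuot (hasDerivAt_symmAvg hc))
            nonneg := fun x => le_symmAvg_symmAvg_symmAvg ha hc fun t _ => h0 t
            le_one := fun x => symmAvg_symmAvg_symmAvg_le ha hc fun t _ => h1 t
            abs_d1_le := abs_symmQuot_le_of_lipschitz ha hl2
            abs_d2_le := fun x => ?_
            abs_d3_le := fun x => ?_ }, ?_, ?_⟩
  · rw [← hinv]
    exact abs_symmQuot_le_of_bounded ha (abs_symmQuot_le_of_lipschitz ha hl1) x
  · have := abs_symmQuot_le_of_bounded ha (abs_symmQuot_le_of_bounded ha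
      (abs_symmQuot_le_of_lipschitz ha hlip)) x
    rw [hinv, hinv] at this
    linarith
  · intro x hx
    refine le_antisymm (symmAvg_symmAvg_symmAvg_le ha hc fun t _ => h1 t)
      (le_symmAvg_symmAvg_symmAvg ha hc fun t ht => ?_)
    have h2 := abs_infDist_sub_infDist_le B t x
    have h3 := abs_le.1 (h2.trans (ht.trans_eq h3a))
    simp only [hh]
    rw [max_eq_left (by linarith [h3.2] : Metric.infDist t B - (e + β⁻¹) ≤ 0)]
    simp
  · intro x hx
    refine le_antisymm (symmAvg_symmAvg_symmAvg_le ha hc fun t ht => ?_)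
      (le_symmAvg_symmAvg_symmAvg ha hc fun t _ => h0 t)
    have h2 := abs_infDist_sub_infDist_le B t x
    have h3 := abs_le.1 (h2.trans (ht.trans_eq h3a))
    simp only [hh]
    refine max_le le_rfl ?_
    have h4 : δ ≤ max 0 (Metric.infDist t B - (e + β⁻¹)) := le_max_of_le_right (by linarith [h3.1])
    have h5 : δ⁻¹ * δ ≤ δ⁻¹ * max 0 (Metric.infDist t B - (e + β⁻¹)) := by gcongr
    rw [inv_mul_cancel₀ hδ.ne'] at h5
    linarith

/-! ### The maximum, the soft maximum and its Gibbs weights -/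

section VecMax

variable {ι : Type*} [Fintype ι] [Nonempty ι]

lemma le_vecMax (x : ι → ℝ) (j : ι) : x j ≤ vecMax x :=
  Finset.le_sup' x (Finset.mem_univ j)

lemma vecMax_le {x : ι → ℝ} {c : ℝ} (h : ∀ j, x j ≤ c) : vecMax x ≤ c :=
  Finset.sup'_le _ _ fun j _ => h j

lemma vecMax_nonneg {x : ι → ℝ} (h : ∀ j, 0 ≤ x j) : 0 ≤ vecMax x :=
  (h (Classical.arbitrary ι)).trans (le_vecMax x _)

lemma vecMax_le_sum {x : ι → ℝ} (h : ∀ j, 0 ≤ x j) : vecMax x ≤ ∑ j, x j :=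
  vecMax_le fun j => Finset.single_le_sum (fun k _ => h k) (Finset.mem_univ j)

lemma continuous_vecMax : Continuous (vecMax : (ι → ℝ) → ℝ) := by
  have h : Continuous fun x : ι → ℝ => Finset.univ.sup' Finset.univ_nonempty fun i => x i :=
    Continuous.finset_sup'_apply _ fun i _ => continuous_apply i
  exact h

lemma measurable_vecMax : Measurable (vecMax : (ι → ℝ) → ℝ) :=
  continuous_vecMax.measurable

end VecMax

section Gibbs

variable {ι : Type*} [Fintype ι]

/-- The soft maximum `β⁻¹ log ∑ exp (β w_j)`. -/
noncomputable def lse (β : ℝ) (w : ι → ℝ) : ℝ := β⁻¹ * Real.log (∑ j, Real.exp (β * w j))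

/-- The Gibbs weights `exp (β w_j) / ∑ exp (β w_k)`. -/
noncomputable def gibbs (β : ℝ) (w : ι → ℝ) (j : ι) : ℝ :=
  Real.exp (β * w j) / ∑ k, Real.exp (β * w k)

variable {L β : ℝ}

lemma gibbs_nonneg (β : ℝ) (w : ι → ℝ) (j : ι) : 0 ≤ gibbs β w j := by
  unfold gibbs
  positivity

@[fun_prop]
lemma continuous_gibbs [Nonempty ι] (β : ℝ) (j : ι) : Continuous fun w : ι → ℝ => gibbs β w j := by
  unfold gibbs
  refine Continuous.div (by fun_prop) (by fun_prop) fun w => ?_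
  exact (Finset.sum_pos (fun k _ => Real.exp_pos _) Finset.univ_nonempty).ne'

@[fun_prop]
lemma continuous_lse [Nonempty ι] (β : ℝ) : Continuous fun w : ι → ℝ => lse β w := by
  unfold lse
  refine continuous_const.mul (Continuous.log (by fun_prop) fun w => ?_)
  exact (Finset.sum_pos (fun k _ => Real.exp_pos _) Finset.univ_nonempty).ne'

variable [Nonempty ι]

lemma sum_exp_pos (β : ℝ) (w : ι → ℝ) : 0 < ∑ j, Real.exp (β * w j) :=
  Finset.sum_pos (fun _ _ => Real.exp_pos _) Finset.univ_nonempty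

lemma sum_gibbs (β : ℝ) (w : ι → ℝ) : ∑ j, gibbs β w j = 1 := by
  unfold gibbs
  rw [← Finset.sum_div, div_self (sum_exp_pos β w).ne']

lemma gibbs_le_one (β : ℝ) (w : ι → ℝ) (j : ι) : gibbs β w j ≤ 1 := by
  rw [← sum_gibbs β w]
  exact Finset.single_le_sum (fun k _ => gibbs_nonneg β w k) (Finset.mem_univ j)

lemma vecMax_le_lse (hβ : 0 < β) (w : ι → ℝ) : vecMax w ≤ lse β w := by
  refine vecMax_le fun j => ?_
  rw [lse, ← div_eq_inv_mul, le_div_iff₀ hβ, mul_comm, Real.le_log_iff_exp_le (sum_exp_pos β w)]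
  exact Finset.single_le_sum (f := fun j => Real.exp (β * w j)) (fun k _ => (Real.exp_pos _).le)
    (Finset.mem_univ j)

lemma lse_le_vecMax_add (hβ : 0 < β) (w : ι → ℝ) :
    lse β w ≤ vecMax w + β⁻¹ * Real.log (Fintype.card ι) := by
  have h : ∑ j, Real.exp (β * w j) ≤ Fintype.card ι * Real.exp (β * vecMax w) := by
    rw [← nsmul_eq_mul, ← Finset.card_univ]
    refine Finset.sum_le_card_nsmul _ _ _ fun j _ => ?_
    have := le_vecMax w j
    gcongr
  have hc : (0 : ℝ) < Fintype.card ι := by exact_mod_cast Fintype.card_pos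
  have h2 := Real.log_le_log (sum_exp_pos β w) h
  rw [Real.log_mul hc.ne' (Real.exp_pos _).ne', Real.log_exp] at h2
  calc lse β w ≤ β⁻¹ * (Real.log (Fintype.card ι) + β * vecMax w) := by unfold lse; gcongr
    _ = _ := by field_simp; ring

/-- Derivatives are taken along arbitrary differentiable curves instead of as Fréchet derivatives:
the same lemmas then serve segments, affine substitutions and the trigonometric interpolation path.
-/
lemma hasDerivAt_sum_exp {c : ι → ℝ → ℝ} {c' : ι → ℝ} {t : ℝ}
    (hc : ∀ j, HasDerivAt (c j) (c' j) t) :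
    HasDerivAt (fun s => ∑ j, Real.exp (β * c j s))
      (β * (∑ k, Real.exp (β * c k t)) * ∑ j, gibbs β (fun k => c k t) j * c' j) t := by
  have h := HasDerivAt.fun_sum (u := Finset.univ) fun j _ => ((hc j).const_mul β).exp
  refine h.congr_deriv ?_
  rw [mul_assoc, Finset.mul_sum, Finset.mul_sum]
  refine Finset.sum_congr rfl fun j _ => ?_
  have := (sum_exp_pos β fun k => c k t).ne'
  unfold gibbs
  field_simp

lemma hasDerivAt_lse (hβ : 0 < β) {c : ι → ℝ → ℝ} {c' : ι → ℝ} {t : ℝ}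
    (hc : ∀ j, HasDerivAt (c j) (c' j) t) :
    HasDerivAt (fun s => lse β fun j => c j s) (∑ j, gibbs β (fun k => c k t) j * c' j) t := by
  have h := ((hasDerivAt_sum_exp (β := β) hc).log
    (sum_exp_pos β fun k => c k t).ne').const_mul β⁻¹
  refine h.congr_deriv ?_
  have := (sum_exp_pos β fun k => c k t).ne'
  field_simp

lemma hasDerivAt_gibbs {c : ι → ℝ → ℝ} {c' : ι → ℝ} {t : ℝ}
    (hc : ∀ j, HasDerivAt (c j) (c' j) t) (j : ι) :
    HasDerivAt (fun s => gibbs β (fun k => c k s) j)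
      (β * gibbs β (fun k => c k t) j *
        (c' j - ∑ k, gibbs β (fun k => c k t) k * c' k)) t := by
  have h0 := (sum_exp_pos β fun k => c k t).ne'
  have h := ((hc j).const_mul β).exp.div (hasDerivAt_sum_exp (β := β) hc) h0
  refine h.congr_deriv ?_
  generalize ∑ k, gibbs β (fun k => c k t) k * c' k = m
  unfold gibbs
  field_simp

/-- Gradient of `g ∘ lse`. -/
noncomputable def grad (g : TestFun L β) (w : ι → ℝ) (j : ι) : ℝ := g.d1 (lse β w) * gibbs β w j

/-- Hessian of `g ∘ lse`. -/
noncomputable def hess [DecidableEq ι] (g : TestFun L β) (w : ι → ℝ) (j k : ι) : ℝ :=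
  g.d2 (lse β w) * (gibbs β w j * gibbs β w k) +
    β * g.d1 (lse β w) * ((if j = k then gibbs β w j else 0) - gibbs β w j * gibbs β w k)

lemma hasDerivAt_comp_lse (hβ : 0 < β) (g : TestFun L β) {c : ι → ℝ → ℝ} {c' : ι → ℝ} {t : ℝ}
    (hc : ∀ j, HasDerivAt (c j) (c' j) t) :
    HasDerivAt (fun s => g.toFun (lse β fun j => c j s))
      (∑ j, grad g (fun k => c k t) j * c' j) t := by
  refine ((g.hasDerivAt _).comp t (hasDerivAt_lse hβ hc)).congr_deriv ?_
  rw [Finset.mul_sum]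
  exact Finset.sum_congr rfl fun j _ => by rw [grad, mul_assoc]

lemma hasDerivAt_grad [DecidableEq ι] (hβ : 0 < β) (g : TestFun L β) {c : ι → ℝ → ℝ} {c' : ι → ℝ}
    {t : ℝ} (hc : ∀ j, HasDerivAt (c j) (c' j) t) (j : ι) :
    HasDerivAt (fun s => grad g (fun k => c k s) j)
      (∑ k, hess g (fun k => c k t) j k * c' k) t := by
  have h := ((g.hasDerivAt_d1 _).comp t (hasDerivAt_lse hβ hc)).mul (hasDerivAt_gibbs (β := β) hc j)
  refine h.congr_deriv ?_
  have h1 : ∀ k, hess g (fun k => c k t) j k * c' k =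
      (g.d2 (lse β fun k => c k t) - β * g.d1 (lse β fun k => c k t)) *
        gibbs β (fun k => c k t) j * (gibbs β (fun k => c k t) k * c' k) +
      β * g.d1 (lse β fun k => c k t) * (if j = k then gibbs β (fun k => c k t) j * c' k else 0) := by
    intro k
    unfold hess
    split_ifs <;> ring
  simp only [h1, Finset.sum_add_distrib, ← Finset.mul_sum, Finset.sum_ite_eq, Finset.mem_univ,
    if_true, Function.comp]
  ring

lemma continuous_grad (g : TestFun L β) (j : ι) : Continuous fun w : ι → ℝ => grad g w j := by
  have : Continuous g.d1 := continuous_iff_continuousAt.2 fun x => (g.hasDerivAt_d1 x).continuousAt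
  unfold grad
  fun_prop

lemma continuous_hess [DecidableEq ι] (g : TestFun L β) (j k : ι) :
    Continuous fun w : ι → ℝ => hess g w j k := by
  have : Continuous g.d1 := continuous_iff_continuousAt.2 fun x => (g.hasDerivAt_d1 x).continuousAt
  have : Continuous g.d2 := continuous_iff_continuousAt.2 fun x => (g.hasDerivAt_d2 x).continuousAt
  unfold hess
  split_ifs <;> fun_prop

lemma TestFun.L_nonneg (g : TestFun L β) : 0 ≤ L := (abs_nonneg _).trans (g.abs_d1_le 0)

lemma abs_grad_le (g : TestFun L β) (w : ι → ℝ) (j : ι) : |grad g w j| ≤ L := by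
  rw [grad, abs_mul, abs_of_nonneg (gibbs_nonneg β w j)]
  calc _ ≤ L * 1 := mul_le_mul (g.abs_d1_le _) (gibbs_le_one β w j) (gibbs_nonneg β w j) g.L_nonneg
    _ = L := mul_one L

/-- The weights sum to one, so the ℓ¹ norm of the Hessian does not see the dimension: 3Lβ comes from
the second derivative of g and 2Lβ from the covariance matrix of the weights. The ℓ¹ norm is dual to
the entrywise maximum that defines B₁. -/
lemma sum_abs_hess_le [DecidableEq ι] (hβ : 0 < β) (g : TestFun L β) (w : ι → ℝ) :
    ∑ j, ∑ k, |hess g w j k| ≤ 5 * L * β := by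
  have hL := g.L_nonneg
  have h : ∀ j k, |hess g w j k| ≤ 4 * L * β * (gibbs β w j * gibbs β w k) +
      L * β * (if j = k then gibbs β w j else 0) := by
    intro j k
    have hp : 0 ≤ gibbs β w j * gibbs β w k := mul_nonneg (gibbs_nonneg β w j) (gibbs_nonneg β w k)
    have hi : 0 ≤ (if j = k then gibbs β w j else 0) := by
      split_ifs
      exacts [gibbs_nonneg β w j, le_rfl]
    have h1 := g.abs_d1_le (lse β w)
    have h2 := g.abs_d2_le (lse β w)
    unfold hess
    calc _ ≤ |g.d2 (lse β w) * (gibbs β w j * gibbs β w k)| + _ := abs_add_le _ _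
      _ ≤ 3 * L * β * (gibbs β w j * gibbs β w k) + β * L *
          ((if j = k then gibbs β w j else 0) + gibbs β w j * gibbs β w k) := by
        rw [abs_mul (g.d2 _), abs_mul (β * _), abs_mul β, abs_of_nonneg hp, abs_of_pos hβ]
        gcongr
        exact (abs_sub _ _).trans (by rw [abs_of_nonneg hp, abs_of_nonneg hi])
      _ = _ := by ring
  calc _ ≤ ∑ j, ∑ k, (4 * L * β * (gibbs β w j * gibbs β w k) +
      L * β * (if j = k then gibbs β w j else 0)) :=
        Finset.sum_le_sum fun j _ => Finset.sum_le_sum fun k _ => h j k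
    _ = 5 * L * β := by
      simp only [Finset.sum_add_distrib, ← Finset.mul_sum, Finset.sum_ite_eq, Finset.mem_univ,
        if_true, sum_gibbs, mul_one]
      ring

lemma abs_hess_le [DecidableEq ι] (hβ : 0 < β) (g : TestFun L β) (w : ι → ℝ) (j k : ι) :
    |hess g w j k| ≤ 5 * L * β := by
  refine le_trans ?_ (sum_abs_hess_le hβ g w)
  refine le_trans ?_ (Finset.single_le_sum (f := fun j => ∑ k, |hess g w j k|)
    (fun i _ => Finset.sum_nonneg fun _ _ => abs_nonneg _) (Finset.mem_univ j))
  exact Finset.single_le_sum (f := fun k => |hess g w j k|)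
    (fun i _ => abs_nonneg _) (Finset.mem_univ k)

end Gibbs

/-! ### Moment inequalities for a probability vector -/

section WeightedMoments

variable {ι : Type*} [Fintype ι] {π v : ι → ℝ}

lemma abs_sum_weight_mul_le (h0 : ∀ j, 0 ≤ π j) (r : ℕ) :
    |∑ j, π j * v j ^ r| ≤ ∑ j, π j * |v j| ^ r := by
  refine (Finset.abs_sum_le_sum_abs _ _).trans_eq (Finset.sum_congr rfl fun j _ => ?_)
  rw [abs_mul, abs_of_nonneg (h0 j), abs_pow]

lemma pow_abs_mean_le (h0 : ∀ j, 0 ≤ π j) (h1 : ∑ j, π j = 1) (r : ℕ) :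
    |∑ j, π j * v j| ^ r ≤ ∑ j, π j * |v j| ^ r := by
  have h := abs_sum_weight_mul_le (v := v) h0 1
  simp only [pow_one] at h
  refine (pow_le_pow_left₀ (abs_nonneg _) h r).trans ?_
  exact Real.pow_arith_mean_le_arith_mean_pow _ _ _ (fun j _ => h0 j) h1 (fun j _ => abs_nonneg _) r

/-- With a the mean of |v|, the inequality (|v| + a)(|v| - a)² ≥ 0 reads a²(|v| - a) ≤ |v|³ - a v².
Averaging makes the left side vanish. -/
lemma abs_mean_mul_sq_le (h0 : ∀ j, 0 ≤ π j) (h1 : ∑ j, π j = 1) :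
    |∑ j, π j * v j| * ∑ j, π j * v j ^ 2 ≤ ∑ j, π j * |v j| ^ 3 := by
  have h := abs_sum_weight_mul_le (v := v) h0 1
  simp only [pow_one] at h
  set a := ∑ j, π j * |v j| with ha
  have ha0 : 0 ≤ a := (abs_nonneg _).trans h
  have h2 : 0 ≤ ∑ j, π j * v j ^ 2 := Finset.sum_nonneg fun j _ => mul_nonneg (h0 j) (sq_nonneg _)
  have key : ∑ j, π j * (a ^ 2 * (|v j| - a)) ≤ ∑ j, π j * (|v j| ^ 3 - a * v j ^ 2) := by
    refine Finset.sum_le_sum fun j _ => mul_le_mul_of_nonneg_left ?_ (h0 j)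
    rw [← sq_abs (v j)]
    nlinarith [mul_nonneg (add_nonneg (abs_nonneg (v j)) ha0) (sq_nonneg (|v j| - a))]
  have e1 : ∑ j, π j * (a ^ 2 * (|v j| - a)) = 0 := by
    have : ∀ j, π j * (a ^ 2 * (|v j| - a)) = a ^ 2 * (π j * |v j|) - a ^ 3 * π j := fun j => by ring
    simp only [this, Finset.sum_sub_distrib, ← Finset.mul_sum, ← ha, h1]
    ring
  have e2 : ∑ j, π j * (|v j| ^ 3 - a * v j ^ 2) =
      ∑ j, π j * |v j| ^ 3 - a * ∑ j, π j * v j ^ 2 := by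
    rw [Finset.mul_sum, ← Finset.sum_sub_distrib]
    exact Finset.sum_congr rfl fun j _ => by ring
  rw [e1, e2] at key
  have := mul_le_mul_of_nonneg_right h h2
  linarith

end WeightedMoments

lemma hasDerivAt_line {ι : Type*} (w v : ι → ℝ) (t : ℝ) (j : ι) :
    HasDerivAt (fun s => w j + s * v j) (v j) t := by
  simpa using ((hasDerivAt_id t).mul_const (v j)).const_add (w j)

/-! ### Third-order bounds for g ∘ `lse` along a line -/

section ThirdOrder

variable {ι : Type*} [Fintype ι] {L β : ℝ}

/-- Moment of order `r` of `v` under the Gibbs weights at `w`. -/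
noncomputable def gibbsMoment (β : ℝ) (v w : ι → ℝ) (r : ℕ) : ℝ := ∑ j, gibbs β w j * v j ^ r

lemma sum_hess_mul [DecidableEq ι] (g : TestFun L β) (w v : ι → ℝ) :
    ∑ j, (∑ k, hess g w j k * v k) * v j = g.d2 (lse β w) * gibbsMoment β v w 1 ^ 2 +
      β * g.d1 (lse β w) * (gibbsMoment β v w 2 - gibbsMoment β v w 1 ^ 2) := by
  have h1 : ∀ j k, hess g w j k * v k =
      (g.d2 (lse β w) - β * g.d1 (lse β w)) * gibbs β w j * (gibbs β w k * v k) +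
      β * g.d1 (lse β w) * (if j = k then gibbs β w j * v k else 0) := by
    intro j k
    unfold hess
    split_ifs <;> ring
  have h2 : ∀ j, (∑ k, hess g w j k * v k) * v j =
      (g.d2 (lse β w) - β * g.d1 (lse β w)) * gibbsMoment β v w 1 * (gibbs β w j * v j) +
      β * g.d1 (lse β w) * (gibbs β w j * v j ^ 2) := by
    intro j
    simp only [h1, Finset.sum_add_distrib, ← Finset.mul_sum, Finset.sum_ite_eq, Finset.mem_univ,
      if_true, gibbsMoment, pow_one]
    ring
  simp only [h2, Finset.sum_add_distrib, ← Finset.mul_sum]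
  simp only [gibbsMoment, pow_one]
  ring

variable [Nonempty ι]

/-- Moving `w` along `v` tilts the Gibbs measure exponentially, so a moment changes at β times its
covariance with `v`. Hence all directional derivatives are polynomials in the moments. -/
lemma hasDerivAt_gibbsMoment (w v : ι → ℝ) (r : ℕ) (t : ℝ) :
    HasDerivAt (fun s => gibbsMoment β v (fun j => w j + s * v j) r)
      (β * (gibbsMoment β v (fun j => w j + t * v j) (r + 1) -
        gibbsMoment β v (fun j => w j + t * v j) r *
          gibbsMoment β v (fun j => w j + t * v j) 1)) t := by
  have h := HasDerivAt.fun_sum (u := Finset.univ) fun j _ =>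
    (hasDerivAt_gibbs (β := β) (fun j => hasDerivAt_line w v t j) j).mul_const (v j ^ r)
  refine h.congr_deriv ?_
  simp only [gibbsMoment, pow_one]
  generalize ∑ k, gibbs β (fun j => w j + t * v j) k * v k = m
  rw [Finset.sum_mul, ← Finset.sum_sub_distrib, Finset.mul_sum]
  exact Finset.sum_congr rfl fun j _ => by ring

/-- The derivative is g''' m₁³ + 3β g'' m₁(m₂ - m₁²) + β² g' (m₃ - 3m₁m₂ + 2m₁³), the last bracket
being the third cumulant. In terms of the third absolute moment the three terms cost 9, 9 and 6
times Lβ², hence 24. -/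
lemma exists_hasDerivAt_secondOrder [DecidableEq ι] (hβ : 0 < β) (g : TestFun L β) (w v : ι → ℝ)
    (t : ℝ) : ∃ q, |q| ≤ 24 * L * β ^ 2 * ∑ j, gibbs β (fun j => w j + t * v j) j * |v j| ^ 3 ∧
      HasDerivAt (fun s => ∑ j, (∑ k, hess g (fun j => w j + s * v j) j k * v k) * v j) q t := by
  have hL := g.L_nonneg
  simp only [sum_hess_mul]
  have hF := hasDerivAt_lse hβ fun j => hasDerivAt_line w v t j
  have hm1 := hasDerivAt_gibbsMoment (β := β) w v 1 t
  have hm2 := hasDerivAt_gibbsMoment (β := β) w v 2 t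
  have hd2 := (g.hasDerivAt_d2 _).comp t hF
  have hd1 := (g.hasDerivAt_d1 _).comp t hF
  have H := (hd2.mul (hm1.pow 2)).add ((hd1.const_mul β).mul (hm2.sub (hm1.pow 2)))
  refine ⟨_, ?_, H⟩
  have e1 : gibbsMoment β v (fun j => w j + t * v j) 1 =
      ∑ j, gibbs β (fun j => w j + t * v j) j * v j := by simp [gibbsMoment]
  simp only [Function.comp, Pi.pow_apply, Pi.sub_apply, ← e1]
  set x : ι → ℝ := fun j => w j + t * v j
  have p1 := pow_abs_mean_le (v := v) (gibbs_nonneg β x) (sum_gibbs β x) 3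
  have p2 := abs_mean_mul_sq_le (v := v) (gibbs_nonneg β x) (sum_gibbs β x)
  have p3 := abs_sum_weight_mul_le (v := v) (gibbs_nonneg β x) 3
  have p4 := pow_abs_mean_le (v := v) (gibbs_nonneg β x) (sum_gibbs β x) 2
  simp only [sq_abs] at p4
  rw [← e1] at p1 p2 p4
  change _ ≤ gibbsMoment β v x 2 at p4
  change _ * gibbsMoment β v x 2 ≤ _ at p2
  change |gibbsMoment β v x 3| ≤ _ at p3
  have b1 := g.abs_d1_le (lse β x)
  have b2 := g.abs_d2_le (lse β x)
  have b3 := g.abs_d3_le (lse β x)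
  generalize g.d1 (lse β x) = D1 at *
  generalize g.d2 (lse β x) = D2 at *
  generalize g.d3 (lse β x) = D3 at *
  generalize gibbsMoment β v x 1 = m1 at *
  generalize h2 : gibbsMoment β v x 2 = m2 at *
  generalize h3 : gibbsMoment β v x 3 = m3 at *
  generalize ∑ j, gibbs β x j * |v j| ^ 3 = A at *
  have hA : 0 ≤ A := (abs_nonneg _).trans p3
  have c1 : |m1 ^ 3| ≤ A := by rw [abs_pow]; exact p1
  have hm2 : 0 ≤ m2 := (sq_nonneg _).trans p4
  have c2 : |m1 * m2| ≤ A := by rw [abs_mul, abs_of_nonneg hm2]; exact p2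
  have c4 : |m1 * (m2 - m1 ^ 2)| ≤ A := by
    rw [abs_mul, abs_of_nonneg (sub_nonneg.2 p4)]
    refine le_trans (mul_le_mul_of_nonneg_left ?_ (abs_nonneg m1)) p2
    linarith [sq_nonneg m1]
  have c5 : |m3 - 3 * (m1 * m2) + 2 * m1 ^ 3| ≤ 6 * A := by
    rw [abs_le] at *
    constructor <;> linarith [c1.1, c1.2, c2.1, c2.2, p3.1, p3.2]
  have t1 : |D3 * m1 ^ 3| ≤ 9 * L * β ^ 2 * A := by
    rw [abs_mul]; exact mul_le_mul b3 c1 (abs_nonneg _) (by positivity)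
  have t2 : |3 * β * (D2 * (m1 * (m2 - m1 ^ 2)))| ≤ 9 * L * β ^ 2 * A := by
    rw [abs_mul, abs_mul D2, abs_of_nonneg (by positivity : 0 ≤ 3 * β)]
    calc _ ≤ 3 * β * (3 * L * β * A) := by gcongr
      _ = _ := by ring
  have t3 : |β ^ 2 * (D1 * (m3 - 3 * (m1 * m2) + 2 * m1 ^ 3))| ≤ 6 * L * β ^ 2 * A := by
    rw [abs_mul, abs_mul D1, abs_of_nonneg (by positivity : 0 ≤ β ^ 2)]
    calc _ ≤ β ^ 2 * (L * (6 * A)) := by gcongr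
      _ = _ := by ring
  calc _ = |D3 * m1 ^ 3 + 3 * β * (D2 * (m1 * (m2 - m1 ^ 2))) +
        β ^ 2 * (D1 * (m3 - 3 * (m1 * m2) + 2 * m1 ^ 3))| := by
        congr 1
        norm_num [h2, h3]
        ring
    _ ≤ 24 * L * β ^ 2 * A := by
      refine (abs_add_three _ _ _).trans ?_
      linarith

/-- Shifts of at most β⁻¹/2 change every exponential by a factor between e^(-1/2) and e^(1/2), hence
the weights by at most e < 3. This is the origin of the truncation level in B₃. -/
lemma gibbs_le_three_mul (hβ : 0 < β) {w u : ι → ℝ} (hu : ∀ j, |u j| ≤ β⁻¹ / 2) (j : ι) :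
    gibbs β (fun j => w j + u j) j ≤ 3 * gibbs β w j := by
  have hb : ∀ j, |β * u j| ≤ 1 / 2 := fun j => by
    rw [abs_mul, abs_of_pos hβ]
    calc β * |u j| ≤ β * (β⁻¹ / 2) := by gcongr; exact hu j
      _ = 1 / 2 := by field_simp
  have h1 : ∀ k, Real.exp (-(1 / 2)) * Real.exp (β * w k) ≤ Real.exp (β * (w k + u k)) := fun k => by
    rw [← Real.exp_add]
    have := (abs_le.1 (hb k)).1
    gcongr
    linarith
  have h2 : Real.exp (β * (w j + u j)) ≤ Real.exp (1 / 2) * Real.exp (β * w j) := by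
    rw [← Real.exp_add]
    have := (abs_le.1 (hb j)).2
    gcongr
    linarith
  have hs : Real.exp (-(1 / 2)) * ∑ k, Real.exp (β * w k) ≤ ∑ k, Real.exp (β * (w k + u k)) := by
    rw [Finset.mul_sum]
    exact Finset.sum_le_sum fun k _ => h1 k
  have hpos := sum_exp_pos β w
  have he : Real.exp (1 / 2) * Real.exp (1 / 2) ≤ 3 := by
    rw [← Real.exp_add]
    norm_num
    exact Real.exp_one_lt_three.le
  unfold gibbs
  calc _ ≤ (Real.exp (1 / 2) * Real.exp (β * w j)) /
        (Real.exp (-(1 / 2)) * ∑ k, Real.exp (β * w k)) := by gcongr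
    _ = Real.exp (1 / 2) * Real.exp (1 / 2) *
        (Real.exp (β * w j) / ∑ k, Real.exp (β * w k)) := by
        rw [Real.exp_neg]
        field_simp
    _ ≤ _ := by gcongr

/-- The cube of the maximal coordinate of `v`, truncated from below at `β⁻¹ / 2`. -/
noncomputable def bigCube (β : ℝ) (v : ι → ℝ) : ℝ :=
  Set.indicator {v : ι → ℝ | vecMax (fun j => |v j|) > β⁻¹ / 2}
    (fun v => vecMax fun j => |v j| ^ 3) v

lemma bigCube_nonneg (β : ℝ) (v : ι → ℝ) : 0 ≤ bigCube β v :=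
  Set.indicator_nonneg (fun v _ => vecMax_nonneg fun j => by positivity) v

/-- A small `v` lets the weights be frozen at `w`; a large `v` is charged to its maximal cube.
Frozen weights are common to all summands X_i, so that later the sum over i can be taken inside the
maximum over j, as B₂ requires. -/
lemma sum_gibbs_shift_le (hβ : 0 < β) (w v : ι → ℝ) {t : ℝ} (ht : |t| ≤ 1) :
    ∑ j, gibbs β (fun j => w j + t * v j) j * |v j| ^ 3 ≤
      3 * ∑ j, gibbs β w j * |v j| ^ 3 + bigCube β v := by
  have h0 : 0 ≤ ∑ j, gibbs β w j * |v j| ^ 3 :=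
    Finset.sum_nonneg fun j _ => mul_nonneg (gibbs_nonneg β w j) (by positivity)
  by_cases hv : vecMax (fun j => |v j|) > β⁻¹ / 2
  · rw [bigCube, Set.indicator_of_mem (by exact hv)]
    have : ∑ j, gibbs β (fun j => w j + t * v j) j * |v j| ^ 3 ≤ vecMax fun j => |v j| ^ 3 := by
      calc _ ≤ ∑ j, gibbs β (fun j => w j + t * v j) j * vecMax fun j => |v j| ^ 3 :=
            Finset.sum_le_sum fun j _ => mul_le_mul_of_nonneg_left
              (le_vecMax (fun j => |v j| ^ 3) j) (gibbs_nonneg _ _ _)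
        _ = _ := by rw [← Finset.sum_mul, sum_gibbs, one_mul]
    linarith
  · rw [bigCube, Set.indicator_of_notMem (by exact hv), add_zero, Finset.mul_sum]
    refine Finset.sum_le_sum fun j _ => ?_
    rw [← mul_assoc]
    refine mul_le_mul_of_nonneg_right (gibbs_le_three_mul hβ (fun k => ?_) j) (by positivity)
    rw [abs_mul]
    have h1 := (le_vecMax (fun j => |v j|) k).trans (not_lt.1 hv)
    calc |t| * |v k| ≤ 1 * |v k| := by gcongr
      _ ≤ _ := by simpa using h1

/-- First-order Taylor estimate for the gradient of `g ∘ lse` along `v`. -/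
theorem abs_grad_taylor_le [DecidableEq ι] (hβ : 0 < β) (g : TestFun L β) (w v : ι → ℝ) {s : ℝ}
    (h0 : 0 ≤ s) (h1 : s ≤ 1) :
    |∑ j, v j * (grad g w j - grad g (fun j => w j - s * v j) j) -
        s * ∑ j, ∑ k, hess g w j k * (v j * v k)| ≤
      24 * L * β ^ 2 * (3 * ∑ j, gibbs β w j * |v j| ^ 3 + bigCube β v) := by
  have hL := g.L_nonneg
  set M := 24 * L * β ^ 2 * (3 * ∑ j, gibbs β w j * |v j| ^ 3 + bigCube β v)
  set q1 : ℝ → ℝ := fun t => ∑ j, grad g (fun j => w j + t * v j) j * v j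
  set q2 : ℝ → ℝ := fun t => ∑ j, (∑ k, hess g (fun j => w j + t * v j) j k * v k) * v j
  have hq1 : ∀ t, HasDerivAt q1 (q2 t) t := fun t =>
    HasDerivAt.fun_sum fun j _ =>
      (hasDerivAt_grad hβ g (fun j => hasDerivAt_line w v t j) j).mul_const (v j)
  choose q3 hq3 hq2 using exists_hasDerivAt_secondOrder hβ g w v
  have habs : ∀ t ∈ Set.Icc (-s) 0, |t| ≤ 1 := fun t ht => by
    rw [abs_le]; constructor <;> linarith [ht.1, ht.2]
  have hM : ∀ t ∈ Set.Icc (-s) 0, |q3 t| ≤ M := fun t ht =>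
    (hq3 t).trans (mul_le_mul_of_nonneg_left (sum_gibbs_shift_le hβ w v (habs t ht)) (by positivity))
  have hz : (0 : ℝ) ∈ Set.Icc (-s) 0 := ⟨by linarith, le_rfl⟩
  have hM0 : 0 ≤ M := (abs_nonneg _).trans (hM 0 hz)
  -- The mean value inequality is applied twice on [-s, 0]: to `q2`, then to t ↦ q1 t - t · q2 0,
  -- whose derivative has just been bounded. The factors |t|, s ≤ 1 are dropped.
  have hq2' : ∀ t ∈ Set.Icc (-s) 0, |q2 t - q2 0| ≤ M := fun t ht => by
    have := Convex.norm_image_sub_le_of_norm_hasDerivWithin_le (f := q2) (f' := q3)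
      (fun z _ => (hq2 z).hasDerivWithinAt) hM (convex_Icc (-s) 0) hz ht
    simp only [Real.norm_eq_abs, sub_zero] at this
    exact this.trans (mul_le_of_le_one_right hM0 (habs t ht))
  have hr := Convex.norm_image_sub_le_of_norm_hasDerivWithin_le (f := fun t => q1 t - t * q2 0)
    (f' := fun t => q2 t - q2 0) (x := -s) (y := 0)
    (fun z _ => ((hq1 z).sub (by simpa using (hasDerivAt_id z).mul_const (q2 0))).hasDerivWithinAt)
    hq2' (convex_Icc (-s) 0) ⟨le_rfl, by linarith⟩ hz
  have hr' := hr.trans (mul_le_of_le_one_right hM0 (by simpa [abs_of_nonneg h0] using h1))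
  refine le_of_eq_of_le ?_ hr'
  rw [Real.norm_eq_abs]
  congr 1
  have e1 : q1 0 = ∑ j, grad g w j * v j := by simp [q1]
  have e2 : q1 (-s) = ∑ j, grad g (fun j => w j - s * v j) j * v j := by
    simp [q1, sub_eq_add_neg]
  have e3 : q2 0 = ∑ j, ∑ k, hess g w j k * (v j * v k) := by
    simp only [q2, zero_mul, add_zero, Finset.sum_mul]
    exact Finset.sum_congr rfl fun j _ => Finset.sum_congr rfl fun k _ => by ring
  rw [← e3, e1, e2]
  have e4 : ∑ j, v j * (grad g w j - grad g (fun j => w j - s * v j) j) =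
      ∑ j, grad g w j * v j - ∑ j, grad g (fun j => w j - s * v j) j * v j := by
    rw [← Finset.sum_sub_distrib]
    exact Finset.sum_congr rfl fun j _ => by ring
  rw [e4]
  ring

end ThirdOrder

/-! ### Gaussian integration by parts via rotation invariance -/

section GaussianIBP

variable {p : ℕ} {τ : Measure (EuclideanSpace ℝ (Fin p))} [IsGaussian τ]

lemma IsGaussian.memLp_two_coord (τ : Measure (EuclideanSpace ℝ (Fin p))) [IsGaussian τ]
    (j : Fin p) : MemLp (fun x : EuclideanSpace ℝ (Fin p) => x j) 2 τ :=
  IsGaussian.memLp_dual τ (EuclideanSpace.proj j) 2 (by simp)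

lemma IsGaussian.integral_coord (h0 : ∫ x, x ∂τ = 0) (j : Fin p) : ∫ x, x j ∂τ = 0 := by
  have := IsGaussian.integral_dual (μ := τ) (EuclideanSpace.proj j)
  rw [h0, map_zero] at this
  exact this

/-- Gaussian integration by parts for centered Gaussian measures. -/
theorem integral_coord_mul_eq (h0 : ∫ x, x ∂τ = 0) {G : (Fin p → ℝ) → ℝ}
    {H : Fin p → (Fin p → ℝ) → ℝ} (hG : Continuous G) (hH : ∀ k, Continuous (H k)) {K : ℝ}
    (hGK : ∀ x, |G x| ≤ K) (hHK : ∀ k x, |H k x| ≤ K)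
    (hd : ∀ (c : Fin p → ℝ → ℝ) (c' : Fin p → ℝ) (t : ℝ), (∀ k, HasDerivAt (c k) (c' k) t) →
      HasDerivAt (fun s => G fun k => c k s) (∑ k, H k (fun k => c k t) * c' k) t) (j : Fin p) :
    ∫ x, x j * G x ∂τ = ∑ k, (∫ x, x j * x k ∂τ) * ∫ x, H k x ∂τ := by
  have hK : 0 ≤ K := (abs_nonneg _).trans (hGK 0)
  set Q := τ.prod τ with hQ
  -- Rotating two independent copies (x, y) by the angle α preserves their joint law, and `V` is the
  -- α-derivative of `W`. Thus E[V_j G(W)] = E[y_j] E[G(x)] = 0 for all α, and differentiating this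
  -- identity at α = 0 gives -E[x_j G(x)] + ∑_k E[y_j y_k] E[H_k(x)] = 0, which is the claim.
  let W : ℝ → EuclideanSpace ℝ (Fin p) × EuclideanSpace ℝ (Fin p) → Fin p → ℝ :=
    fun α z k => Real.cos α * z.1 k + Real.sin α * z.2 k
  let V : ℝ → EuclideanSpace ℝ (Fin p) × EuclideanSpace ℝ (Fin p) → Fin p → ℝ :=
    fun α z k => -Real.sin α * z.1 k + Real.cos α * z.2 k
  have hWc : ∀ α, Continuous (W α) := fun α => by fun_prop
  have hVc : ∀ α, Continuous (V α) := fun α => by fun_prop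
  have hconst : ∀ α, ∫ z, V α z j * G (W α z) ∂Q = 0 := by
    intro α
    have hc : Continuous fun z : EuclideanSpace ℝ (Fin p) × EuclideanSpace ℝ (Fin p) =>
        G z.1 * z.2 j := by fun_prop
    have h1 : ∫ z, G z.1 * z.2 j ∂(Q.map (ContinuousLinearMap.rotation α)) =
        ∫ z, V α z j * G (W α z) ∂Q := by
      rw [integral_map (by fun_prop) hc.aestronglyMeasurable]
      refine integral_congr_ae (.of_forall fun z => ?_)
      simp only [ContinuousLinearMap.rotation_apply]
      rw [mul_comm]
      rfl
    rw [← h1, hQ, IsGaussian.map_rotation_eq_self (by simpa using h0),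
      integral_prod_mul (fun x : EuclideanSpace ℝ (Fin p) => G x)
        fun y : EuclideanSpace ℝ (Fin p) => y j,
      IsGaussian.integral_coord h0, mul_zero]
  have hW : ∀ z α k, HasDerivAt (fun a => W a z k) (V α z k) α := fun z α k =>
    (((Real.hasDerivAt_cos α).mul_const _).add ((Real.hasDerivAt_sin α).mul_const _))
  have hV : ∀ z α k, HasDerivAt (fun a => V a z k) (-W α z k) α := fun z α k =>
    (((Real.hasDerivAt_sin α).neg.mul_const (z.1 k)).add
      ((Real.hasDerivAt_cos α).mul_const (z.2 k))).congr_deriv (by simp only [W]; ring)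
  have hF : ∀ z α, HasDerivAt (fun a => V a z j * G (W a z))
      (-W α z j * G (W α z) + V α z j * ∑ k, H k (W α z) * V α z k) α := fun z α =>
    (hV z α j).mul (hd (fun k a => W a z k) (V α z) α (hW z α))
  let S : Fin p → EuclideanSpace ℝ (Fin p) × EuclideanSpace ℝ (Fin p) → ℝ :=
    fun k z => |z.1 k| + |z.2 k|
  have hS2 : ∀ k, MemLp (S k) 2 Q := fun k =>
    ((IsGaussian.memLp_two_coord τ k).comp_fst τ).abs.add
      ((IsGaussian.memLp_two_coord τ k).comp_snd τ).abs
  have hcs : ∀ α, |Real.cos α| ≤ 1 ∧ |Real.sin α| ≤ 1 := fun α =>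
    ⟨Real.abs_cos_le_one α, Real.abs_sin_le_one α⟩
  have hWS : ∀ α z k, |W α z k| ≤ S k z := fun α z k => by
    refine (abs_add_le _ _).trans ?_
    rw [abs_mul, abs_mul]
    exact add_le_add (mul_le_of_le_one_left (abs_nonneg _) (hcs α).1)
      (mul_le_of_le_one_left (abs_nonneg _) (hcs α).2)
  have hVS : ∀ α z k, |V α z k| ≤ S k z := fun α z k => by
    refine (abs_add_le _ _).trans ?_
    rw [abs_mul, abs_mul, abs_neg]
    exact add_le_add (mul_le_of_le_one_left (abs_nonneg _) (hcs α).2)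
      (mul_le_of_le_one_left (abs_nonneg _) (hcs α).1)
  have hD := hasDerivAt_integral_of_dominated_loc_of_deriv_le (μ := Q) (s := Set.univ) (x₀ := 0)
    (F := fun a z => V a z j * G (W a z))
    (F' := fun α z => -W α z j * G (W α z) + V α z j * ∑ k, H k (W α z) * V α z k)
    (bound := fun z => S j z * K + S j z * ∑ k, K * S k z) Filter.univ_mem
    (.of_forall fun α => by
      refine Continuous.aestronglyMeasurable ?_
      fun_prop)
    (by
      refine Integrable.mono' (((hS2 j).integrable (by norm_num)).mul_const K)
        (Continuous.aestronglyMeasurable (by fun_prop)) (.of_forall fun z => ?_)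
      rw [Real.norm_eq_abs, abs_mul]
      exact mul_le_mul (hVS 0 z j) (hGK _) (abs_nonneg _) ((abs_nonneg _).trans (hVS 0 z j)))
    (Continuous.aestronglyMeasurable (by fun_prop))
    (.of_forall fun z α _ => by
      have hS0 : 0 ≤ S j z := (abs_nonneg _).trans (hVS 0 z j)
      rw [Real.norm_eq_abs]
      refine (abs_add_le _ _).trans ?_
      rw [abs_mul, abs_mul, abs_neg]
      refine add_le_add (mul_le_mul (hWS α z j) (hGK _) (abs_nonneg _) hS0)
        (mul_le_mul (hVS α z j) ?_ (abs_nonneg _) hS0)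
      refine (Finset.abs_sum_le_sum_abs _ _).trans (Finset.sum_le_sum fun k _ => ?_)
      rw [abs_mul]
      exact mul_le_mul (hHK _ _) (hVS α z k) (abs_nonneg _) hK)
    (by
      refine (((hS2 j).integrable (by norm_num)).mul_const K).add ?_
      simp only [Finset.mul_sum]
      refine integrable_finsetSum _ fun k _ => ?_
      have := ((hS2 j).integrable_mul (hS2 k)).const_mul K
      refine this.congr (.of_forall fun z => ?_)
      simp only [Pi.mul_apply]
      ring)
    (.of_forall fun z α _ => hF z α)
  -- The differentiated integral is identically zero, so its derivative at α = 0 vanishes.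
  have hz := hD.2.unique ((hasDerivAt_const (0 : ℝ) (0 : ℝ)).congr_of_eventuallyEq
    (.of_forall fun α => hconst α))
  have hint : ∀ k, Integrable (fun x => x j * x k) τ := fun k =>
    (IsGaussian.memLp_two_coord τ j).integrable_mul (IsGaussian.memLp_two_coord τ k)
  have hHi : ∀ k, Integrable (fun x : EuclideanSpace ℝ (Fin p) => H k x) τ := fun k =>
    Integrable.of_bound (Continuous.aestronglyMeasurable (by have := hH k; fun_prop)) K
      (.of_forall fun x => hHK k _)
  have hGi : Integrable (fun x : EuclideanSpace ℝ (Fin p) => x j * G x) τ :=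
    ((IsGaussian.memLp_two_coord τ j).integrable (by norm_num)).mul_bdd (c := K)
      (Continuous.aestronglyMeasurable (by fun_prop)) (.of_forall fun x => hGK _)
  have e : (fun z => -W 0 z j * G (W 0 z) + V 0 z j * ∑ k, H k (W 0 z) * V 0 z k) =
      fun z => -(z.1 j * G z.1 * 1) + ∑ k, H k z.1 * (z.2 j * z.2 k) := by
    funext z
    have e1 : W 0 z = z.1 := by funext k; simp [W]
    have e2 : V 0 z = z.2 := by funext k; simp [V]
    rw [e1, e2, Finset.mul_sum]
    congr 1
    · ring
    · exact Finset.sum_congr rfl fun k _ => by ring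
  have i1 : Integrable (fun z : EuclideanSpace ℝ (Fin p) × EuclideanSpace ℝ (Fin p) =>
      z.1 j * G z.1 * 1) Q := hGi.mul_prod (integrable_const (1 : ℝ))
  have i2 : ∀ k, Integrable (fun z : EuclideanSpace ℝ (Fin p) × EuclideanSpace ℝ (Fin p) =>
      H k z.1 * (z.2 j * z.2 k)) Q := fun k => (hHi k).mul_prod (hint k)
  have i1n : Integrable (fun z : EuclideanSpace ℝ (Fin p) × EuclideanSpace ℝ (Fin p) =>
      -(z.1 j * G z.1 * 1)) Q := i1.neg
  rw [e, integral_add i1n (integrable_finsetSum _ fun k _ => i2 k), integral_neg,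
    integral_finsetSum _ fun k _ => i2 k,
    integral_prod_mul (fun x : EuclideanSpace ℝ (Fin p) => x j * G x)
      fun _ : EuclideanSpace ℝ (Fin p) => (1 : ℝ)] at hz
  simp only [integral_const, probReal_univ, smul_eq_mul, mul_one] at hz
  have e3 : ∀ k, ∫ z, H k z.1 * (z.2 j * z.2 k) ∂Q = (∫ x, x j * x k ∂τ) * ∫ x, H k x ∂τ := fun k => by
    rw [mul_comm]
    exact integral_prod_mul (fun x : EuclideanSpace ℝ (Fin p) => H k x)
      fun y : EuclideanSpace ℝ (Fin p) => y j * y k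
  simp only [e3] at hz
  linarith

end GaussianIBP

lemma integrable_vecMax {Ω ι : Type*} [MeasurableSpace Ω] {P : Measure Ω} [Fintype ι] [Nonempty ι]
    {f : Ω → ι → ℝ} (hf : ∀ j, Integrable (fun ω => f ω j) P) (h0 : ∀ ω j, 0 ≤ f ω j) :
    Integrable (fun ω => vecMax (f ω)) P := by
  refine Integrable.mono' (integrable_finsetSum Finset.univ fun j _ => hf j)
    (measurable_vecMax.comp_aemeasurable
      (aemeasurable_pi_lambda f fun j => (hf j).aemeasurable)).aestronglyMeasurable
    (.of_forall fun ω => ?_)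
  rw [Real.norm_eq_abs, abs_of_nonneg (vecMax_nonneg (h0 ω))]
  exact vecMax_le_sum (h0 ω)

/-! ### Stein's leave-one-out argument for the sum -/

section Stein

variable {Ω : Type*} [MeasurableSpace Ω] {P : Measure Ω} {n p : ℕ}
  {X : Fin n → Ω → EuclideanSpace ℝ (Fin p)} {L β : ℝ}

lemma measurable_coord (hX : ∀ i, Measurable (X i)) (i : Fin n) (j : Fin p) :
    Measurable fun ω => X i ω j := by
  have := hX i
  fun_prop

lemma memLp_three_coord (hX : ∀ i, Measurable (X i))
    (h3 : ∀ i j, Integrable (fun ω => |X i ω j| ^ 3) P) (i : Fin n) (j : Fin p) :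
    MemLp (fun ω => X i ω j) 3 P := by
  rw [← integrable_norm_rpow_iff (measurable_coord hX i j).aestronglyMeasurable
    (by norm_num) (by norm_num)]
  refine (h3 i j).congr (.of_forall fun ω => ?_)
  simp only [Real.norm_eq_abs, ENNReal.toReal_ofNat]
  exact (Real.rpow_natCast _ 3).symm

lemma memLp_two_coord [IsFiniteMeasure P] (hX : ∀ i, Measurable (X i))
    (h3 : ∀ i j, Integrable (fun ω => |X i ω j| ^ 3) P) (i : Fin n) (j : Fin p) :
    MemLp (fun ω => X i ω j) 2 P :=
  (memLp_three_coord hX h3 i j).mono_exponent (by norm_num)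

lemma integrable_coord [IsFiniteMeasure P] (hX : ∀ i, Measurable (X i))
    (h3 : ∀ i j, Integrable (fun ω => |X i ω j| ^ 3) P) (i : Fin n) (j : Fin p) :
    Integrable (fun ω => X i ω j) P :=
  (memLp_two_coord hX h3 i j).integrable (by norm_num)

lemma integrable_coord_mul [IsFiniteMeasure P] (hX : ∀ i, Measurable (X i))
    (h3 : ∀ i j, Integrable (fun ω => |X i ω j| ^ 3) P) (i : Fin n) (j k : Fin p) :
    Integrable (fun ω => X i ω j * X i ω k) P :=
  (memLp_two_coord hX h3 i j).integrable_mul (memLp_two_coord hX h3 i k)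

variable [NeZero p]

lemma integrable_bigCube (β : ℝ) (hX : ∀ i, Measurable (X i))
    (h3 : ∀ i j, Integrable (fun ω => |X i ω j| ^ 3) P) (i : Fin n) :
    Integrable (fun ω => bigCube β fun j => X i ω j) P := by
  have h := integrable_vecMax (f := fun ω (j : Fin p) => |X i ω j| ^ 3) (h3 i)
    fun ω j => by positivity
  have hm : MeasurableSet {ω | vecMax (fun j : Fin p => |X i ω j|) > β⁻¹ / 2} :=
    measurableSet_lt measurable_const (measurable_vecMax.comp
      (measurable_pi_lambda _ fun j => (measurable_coord hX i j).abs))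
  exact h.indicator hm

lemma B3_eq_sum_integral_bigCube (P : Measure Ω) (X : Fin n → Ω → EuclideanSpace ℝ (Fin p))
    (β : ℝ) : B3 P X β = ∑ i, ∫ ω, bigCube β (fun j => X i ω j) ∂P := rfl

/-- Subtracting s X_i removes the i-th summand from the argument of the gradient, which becomes
independent of the centred vector X_i. -/
lemma integral_coord_mul_leaveOneOut (hX : ∀ i, Measurable (X i)) (hind : iIndepFun X P)
    (hmean : ∀ i j, ∫ ω, X i ω j ∂P = 0) (g : TestFun L β) (u : Fin p → ℝ) (s : ℝ) (i : Fin n)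
    (j : Fin p) :
    ∫ ω, X i ω j * grad g (fun k => u k + s * ∑ i', X i' ω k - s * X i ω k) j ∂P = 0 := by
  have h1 := hind.indepFun_finsetSum_of_notMem hX (Finset.notMem_erase i Finset.univ)
  have hm : Measurable (∑ i' ∈ Finset.univ.erase i, X i') := by
    rw [Finset.sum_fn]
    exact Finset.measurable_sum _ fun i' _ => hX i'
  have h2 := h1.symm.integral_fun_comp_mul_comp (f := fun x : EuclideanSpace ℝ (Fin p) => x j)
    (g := fun x : EuclideanSpace ℝ (Fin p) => grad g (fun k => u k + s * x k) j)
    (hX i).aemeasurable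
    hm.aemeasurable
    (Continuous.aestronglyMeasurable (by fun_prop))
    (((continuous_grad g j).comp (by fun_prop)).aestronglyMeasurable)
  rw [hmean i j, zero_mul] at h2
  rw [← h2]
  refine integral_congr_ae (.of_forall fun ω => ?_)
  simp only [Finset.sum_apply]
  congr 2
  funext k
  rw [← Finset.add_sum_erase Finset.univ (fun i' => X i' ω k) (Finset.mem_univ i)]
  simp
  ring

lemma measurable_grad_comp (g : TestFun L β) {α : Type*} [MeasurableSpace α] {w : α → Fin p → ℝ}
    (hw : ∀ k, Measurable fun a => w a k) (j : Fin p) : Measurable fun a => grad g (w a) j :=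
  (continuous_grad g j).measurable.comp (measurable_pi_lambda w hw)

lemma measurable_hess_comp (g : TestFun L β) {α : Type*} [MeasurableSpace α] {w : α → Fin p → ℝ}
    (hw : ∀ k, Measurable fun a => w a k) (j k : Fin p) : Measurable fun a => hess g (w a) j k :=
  (continuous_hess g j k).measurable.comp (measurable_pi_lambda w hw)

lemma integrable_mul_grad_comp (g : TestFun L β) {α : Type*} [MeasurableSpace α] {μ : Measure α}
    {w : α → Fin p → ℝ} (hw : ∀ k, Measurable fun a => w a k) {f : α → ℝ} (hf : Integrable f μ)
    (j : Fin p) : Integrable (fun a => f a * grad g (w a) j) μ :=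
  hf.mul_bdd (c := L) (measurable_grad_comp g hw j).aestronglyMeasurable
    (.of_forall fun _ => abs_grad_le g _ j)

lemma integrable_hess_comp_mul (hβ : 0 < β) (g : TestFun L β) {α : Type*} [MeasurableSpace α]
    {μ : Measure α} {w : α → Fin p → ℝ} (hw : ∀ k, Measurable fun a => w a k) {f : α → ℝ}
    (hf : Integrable f μ) (j k : Fin p) : Integrable (fun a => hess g (w a) j k * f a) μ :=
  hf.bdd_mul (c := 5 * L * β) (measurable_hess_comp g hw j k).aestronglyMeasurable
    (.of_forall fun _ => abs_hess_le hβ g _ j k)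

/-- Leave-one-out comparison of the first-order and second-order terms for the sum. -/
theorem abs_integral_grad_sub_hess_le [IsProbabilityMeasure P] (hβ : 0 < β) (hX : ∀ i, Measurable (X i))
    (hind : iIndepFun X P) (hmean : ∀ i j, ∫ ω, X i ω j ∂P = 0)
    (h3 : ∀ i j, Integrable (fun ω => |X i ω j| ^ 3) P) (g : TestFun L β) (u : Fin p → ℝ) {s : ℝ}
    (h0 : 0 ≤ s) (h1 : s ≤ 1) :
    |∫ ω, (∑ j, (∑ i, X i ω j) * grad g (fun k => u k + s * ∑ i, X i ω k) j -
        s * ∑ j, ∑ k, hess g (fun k => u k + s * ∑ i, X i ω k) j k *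
          ∑ i, X i ω j * X i ω k) ∂P| ≤
      24 * L * β ^ 2 * (3 * B2 P X + B3 P X β) := by
  have hL := g.L_nonneg
  have hXc := measurable_coord hX
  have hXi := integrable_coord hX h3
  set W : Ω → Fin p → ℝ := fun ω k => u k + s * ∑ i, X i ω k with hW
  have hWm : ∀ k, Measurable fun ω => W ω k := fun k =>
    measurable_const.add ((Finset.measurable_sum _ fun i _ => hXc i k).const_mul s)
  have hWim : ∀ i k, Measurable fun ω => W ω k - s * X i ω k := fun i k =>
    (hWm k).sub ((hXc i k).const_mul s)
  -- The Taylor remainder of the i-th summand between the full point and the point without X_i. The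
  -- gradients at the leave-one-out points integrate to zero against X_i, so only the sum of the `R
  -- i` survives.
  let R : Fin n → Ω → ℝ := fun i ω =>
    ∑ j, X i ω j * (grad g (W ω) j - grad g (fun j => W ω j - s * X i ω j) j) -
      s * ∑ j, ∑ k, hess g (W ω) j k * (X i ω j * X i ω k)
  have hE : ∀ i, ∫ ω, ∑ j, X i ω j * grad g (fun j => W ω j - s * X i ω j) j ∂P = 0 := by
    intro i
    rw [integral_finsetSum _ fun j _ => integrable_mul_grad_comp g (hWim i) (hXi i j) j]
    exact Finset.sum_eq_zero fun j _ => integral_coord_mul_leaveOneOut hX hind hmean g u s i j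
  have hEi : ∀ i, Integrable
      (fun ω => ∑ j, X i ω j * grad g (fun j => W ω j - s * X i ω j) j) P := fun i =>
    integrable_finsetSum _ fun j _ => integrable_mul_grad_comp g (hWim i) (hXi i j) j
  have hRi : ∀ i, Integrable (R i) P := fun i => by
    refine Integrable.sub ?_ (Integrable.const_mul ?_ s)
    · simp only [mul_sub]
      exact integrable_finsetSum _ fun j _ => (integrable_mul_grad_comp g hWm (hXi i j) j).sub
        (integrable_mul_grad_comp g (hWim i) (hXi i j) j)
    · exact integrable_finsetSum _ fun j _ => integrable_finsetSum _ fun k _ =>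
        integrable_hess_comp_mul hβ g hWm (integrable_coord_mul hX h3 i j k) j k
  have hsplit : ∀ ω, ∑ j, (∑ i, X i ω j) * grad g (W ω) j -
      s * ∑ j, ∑ k, hess g (W ω) j k * ∑ i, X i ω j * X i ω k =
      ∑ i, R i ω + ∑ i, ∑ j, X i ω j * grad g (fun j => W ω j - s * X i ω j) j := by
    intro ω
    rw [← Finset.sum_add_distrib]
    have e1 : ∑ j, (∑ i, X i ω j) * grad g (W ω) j = ∑ i, ∑ j, X i ω j * grad g (W ω) j := by
      simp only [Finset.sum_mul]
      exact Finset.sum_comm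
    have e2 : ∑ j, ∑ k, hess g (W ω) j k * ∑ i, X i ω j * X i ω k =
        ∑ i, ∑ j, ∑ k, hess g (W ω) j k * (X i ω j * X i ω k) := by
      simp only [Finset.mul_sum]
      rw [Finset.sum_comm]
      rw [Finset.sum_congr rfl fun k _ => Finset.sum_comm, Finset.sum_comm]
      exact Finset.sum_congr rfl fun i _ => Finset.sum_comm
    rw [e1, e2, Finset.mul_sum, ← Finset.sum_sub_distrib]
    refine Finset.sum_congr rfl fun i _ => ?_
    simp only [R, mul_sub, Finset.sum_sub_distrib]
    ring
  have hbound : ∀ ω, |∑ i, R i ω| ≤ 24 * L * β ^ 2 *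
      (3 * vecMax (fun j => ∑ i, |X i ω j| ^ 3) + ∑ i, bigCube β fun j => X i ω j) := by
    intro ω
    calc |∑ i, R i ω| ≤ ∑ i, |R i ω| := Finset.abs_sum_le_sum_abs _ _
      _ ≤ ∑ i, 24 * L * β ^ 2 * (3 * ∑ j, gibbs β (W ω) j * |X i ω j| ^ 3 +
          bigCube β fun j => X i ω j) := Finset.sum_le_sum fun i _ =>
            abs_grad_taylor_le hβ g (W ω) (fun j => X i ω j) h0 h1
      _ = 24 * L * β ^ 2 * (3 * ∑ j, gibbs β (W ω) j * ∑ i, |X i ω j| ^ 3 +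
          ∑ i, bigCube β fun j => X i ω j) := by
        rw [← Finset.mul_sum, Finset.sum_add_distrib, ← Finset.mul_sum, Finset.sum_comm]
        simp only [Finset.mul_sum]
      _ ≤ _ := by
        refine mul_le_mul_of_nonneg_left ?_ (by positivity)
        refine add_le_add_left (mul_le_mul_of_nonneg_left ?_ (by norm_num)) _
        -- A weighted average over j is at most the maximum over j; the sum over i is already
        -- inside.
        calc _ ≤ ∑ j, gibbs β (W ω) j * vecMax (fun j => ∑ i, |X i ω j| ^ 3) :=
              Finset.sum_le_sum fun j _ => mul_le_mul_of_nonneg_left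
                (le_vecMax (fun j => ∑ i, |X i ω j| ^ 3) j) (gibbs_nonneg _ _ _)
          _ = _ := by rw [← Finset.sum_mul, sum_gibbs, one_mul]
  have hB2 : Integrable (fun ω => vecMax (fun j : Fin p => ∑ i, |X i ω j| ^ 3)) P :=
    integrable_vecMax (fun j => integrable_finsetSum _ fun i _ => h3 i j)
      fun ω j => Finset.sum_nonneg fun i _ => by positivity
  have hB3 : Integrable (fun ω => ∑ i, bigCube β fun j => X i ω j) P :=
    integrable_finsetSum _ fun i _ => integrable_bigCube β hX h3 i
  have hfin : ∫ ω, (∑ j, (∑ i, X i ω j) * grad g (W ω) j -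
      s * ∑ j, ∑ k, hess g (W ω) j k * ∑ i, X i ω j * X i ω k) ∂P = ∫ ω, ∑ i, R i ω ∂P := by
    simp only [hsplit]
    rw [integral_add (integrable_finsetSum _ fun i _ => hRi i)
      (integrable_finsetSum _ fun i _ => hEi i), integral_finsetSum _ fun i _ => hEi i]
    simp only [hE, Finset.sum_const_zero, add_zero]
  rw [hfin]
  calc |∫ ω, ∑ i, R i ω ∂P| ≤ ∫ ω, |∑ i, R i ω| ∂P := abs_integral_le_integral_abs
    _ ≤ ∫ ω, 24 * L * β ^ 2 * (3 * vecMax (fun j => ∑ i, |X i ω j| ^ 3) +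
        ∑ i, bigCube β fun j => X i ω j) ∂P :=
      integral_mono (integrable_finsetSum _ fun i _ => hRi i).abs
        (((hB2.const_mul 3).add hB3).const_mul _) hbound
    _ = _ := by
      rw [integral_const_mul, integral_add (hB2.const_mul 3) hB3, integral_const_mul,
        integral_finsetSum _ fun i _ => integrable_bigCube β hX h3 i,
        B3_eq_sum_integral_bigCube, B2]

end Stein

/-! ### Interpolation between the sum and the Gaussian vector -/

section Interpolation

variable {Ω : Type*} [MeasurableSpace Ω] {P : Measure Ω} [IsProbabilityMeasure P] {n p : ℕ}
  [NeZero p] {X : Fin n → Ω → EuclideanSpace ℝ (Fin p)} {L β : ℝ}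
  {τ : Measure (EuclideanSpace ℝ (Fin p))} [IsGaussian τ]

/-- Gaussian integration by parts for the gradient of `g ∘ lse`. -/
lemma integral_coord_mul_grad (hβ : 0 < β) (h0 : ∫ x, x ∂τ = 0) (g : TestFun L β)
    (u : Fin p → ℝ) (c : ℝ) (j : Fin p) :
    ∫ x, x j * grad g (fun k => c * x k + u k) j ∂τ =
      ∑ k, (∫ x, x j * x k ∂τ) * (c * ∫ x, hess g (fun k => c * x k + u k) j k ∂τ) := by
  have hc : Continuous fun x : Fin p → ℝ => fun k => c * x k + u k := by fun_prop
  have h := integral_coord_mul_eq (τ := τ) h0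
    (G := fun x => grad g (fun k => c * x k + u k) j)
    (H := fun k x => c * hess g (fun k => c * x k + u k) j k)
    (K := max L (|c| * (5 * L * β)))
    ((continuous_grad g j).comp hc)
    (fun k => continuous_const.mul ((continuous_hess g j k).comp hc))
    (fun x => (abs_grad_le g _ j).trans (le_max_left _ _))
    (fun k x => by
      rw [abs_mul]
      exact (mul_le_mul_of_nonneg_left (abs_hess_le hβ g _ j k) (abs_nonneg c)).trans
        (le_max_right _ _))
    (fun b b' t hb => by
      have := hasDerivAt_grad hβ g (fun k => ((hb k).const_mul c).add_const (u k)) j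
      refine this.congr_deriv (Finset.sum_congr rfl fun k _ => by ring)) j
  rw [h]
  exact Finset.sum_congr rfl fun k _ => by rw [integral_const_mul]

/-- Comparison of smooth functions of the soft maximum of a sum of independent vectors and of a
Gaussian vector with the same covariance. -/
theorem abs_integral_sub_integral_le (hβ : 0 < β) (hX : ∀ i, Measurable (X i))
    (hind : iIndepFun X P) (hmean : ∀ i j, ∫ ω, X i ω j ∂P = 0)
    (h3 : ∀ i j, Integrable (fun ω => |X i ω j| ^ 3) P) (h0 : ∫ x, x ∂τ = 0)
    (hcov : ∀ j k, ∫ x, x j * x k ∂τ = ∑ i, ∫ ω, X i ω j * X i ω k ∂P) (g : TestFun L β) :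
    |∫ ω, g.toFun (lse β fun j => ∑ i, X i ω j) ∂P - ∫ x, g.toFun (lse β fun j => x j) ∂τ| ≤
      (24 * L * β ^ 2 * (3 * B2 P X + B3 P X β) + 5 * L * β * B1 P X) * (Real.pi / 2) := by
  have hL := g.L_nonneg
  have hgc : Continuous g.toFun :=
    continuous_iff_continuousAt.2 fun x => (g.hasDerivAt x).continuousAt
  set S : Ω → Fin p → ℝ := fun ω j => ∑ i, X i ω j with hS
  have hSm : ∀ j, Measurable fun ω => S ω j := fun j =>
    Finset.measurable_sum _ fun i _ => measurable_coord hX i j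
  have hSi : ∀ j, Integrable (fun ω => S ω j) P := fun j =>
    integrable_finsetSum _ fun i _ => integrable_coord hX h3 i j
  set Q := P.prod τ with hQ
  -- The trigonometric path has bounded velocity coefficients at both ends, so the final bound is
  -- the uniform derivative bound times the length π/2.
  let W : ℝ → Ω × EuclideanSpace ℝ (Fin p) → Fin p → ℝ :=
    fun θ z j => Real.cos θ * z.2 j + Real.sin θ * S z.1 j
  have hWm : ∀ θ j, Measurable fun z => W θ z j := fun θ j => by
    have := hSm j
    fun_prop
  have hx1 : ∀ j, Integrable (fun z : Ω × EuclideanSpace ℝ (Fin p) => z.2 j) Q := fun j =>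
    ((IsGaussian.memLp_two_coord τ j).integrable (by norm_num)).comp_snd P
  have hs1 : ∀ j, Integrable (fun z : Ω × EuclideanSpace ℝ (Fin p) => S z.1 j) Q := fun j =>
    (hSi j).comp_fst τ
  let V : ℝ → Ω × EuclideanSpace ℝ (Fin p) → Fin p → ℝ :=
    fun θ z j => -Real.sin θ * z.2 j + Real.cos θ * S z.1 j
  have hVm : ∀ θ j, Measurable fun z => V θ z j := fun θ j => by
    have := hSm j
    fun_prop
  have hgm : ∀ θ, Measurable fun z => g.toFun (lse β (W θ z)) := fun θ =>
    (hgc.comp (continuous_lse β)).measurable.comp (measurable_pi_lambda _ fun j => hWm θ j)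
  have hF : ∀ z θ, HasDerivAt (fun t => g.toFun (lse β (W t z)))
      (∑ j, grad g (W θ z) j * V θ z j) θ := fun z θ =>
    hasDerivAt_comp_lse hβ g (c := fun j t => W t z j) fun j =>
      ((Real.hasDerivAt_cos θ).mul_const _).add ((Real.hasDerivAt_sin θ).mul_const _)
  have hD : ∀ θ₀, HasDerivAt (fun t => ∫ z, g.toFun (lse β (W t z)) ∂Q)
      (∫ z, ∑ j, grad g (W θ₀ z) j * V θ₀ z j ∂Q) θ₀ := fun θ₀ =>
    (hasDerivAt_integral_of_dominated_loc_of_deriv_le (μ := Q) (s := Set.univ) (x₀ := θ₀)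
      (F := fun t z => g.toFun (lse β (W t z)))
      (F' := fun θ z => ∑ j, grad g (W θ z) j * V θ z j)
      (bound := fun z => ∑ j, L * (|z.2 j| + |S z.1 j|)) Filter.univ_mem
      (.of_forall fun θ => (hgm θ).aestronglyMeasurable)
      (Integrable.of_bound (hgm θ₀).aestronglyMeasurable 1 (.of_forall fun z => by
        rw [Real.norm_eq_abs, abs_of_nonneg (g.nonneg _)]
        exact g.le_one _))
      (Finset.measurable_sum _ fun j _ =>
        (measurable_grad_comp g (hWm θ₀) j).mul (hVm θ₀ j)).aestronglyMeasurable
      (.of_forall fun z θ _ => by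
        refine (Finset.abs_sum_le_sum_abs _ _).trans (Finset.sum_le_sum fun j _ => ?_)
        rw [abs_mul]
        refine mul_le_mul (abs_grad_le g _ j) ?_ (abs_nonneg _) hL
        refine (abs_add_le _ _).trans ?_
        rw [abs_mul, abs_mul, abs_neg]
        exact add_le_add (mul_le_of_le_one_left (abs_nonneg _) (Real.abs_sin_le_one θ))
          (mul_le_of_le_one_left (abs_nonneg _) (Real.abs_cos_le_one θ)))
      (integrable_finsetSum _ fun j _ => ((hx1 j).abs.add (hs1 j).abs).const_mul L)
      (.of_forall fun z θ _ => hF z θ)).2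
  set M := 24 * L * β ^ 2 * (3 * B2 P X + B3 P X β)
  have hbound : ∀ θ ∈ Set.Icc (0 : ℝ) (Real.pi / 2),
      |∫ z, ∑ j, grad g (W θ z) j * V θ z j ∂Q| ≤ M + 5 * L * β * B1 P X := by
    intro θ hθ
    have hc0 : 0 ≤ Real.cos θ :=
      Real.cos_nonneg_of_mem_Icc ⟨by linarith [hθ.1, Real.pi_pos], hθ.2⟩
    have hs0 : 0 ≤ Real.sin θ :=
      Real.sin_nonneg_of_nonneg_of_le_pi hθ.1 (by linarith [hθ.2, Real.pi_pos])
    have hc1 := Real.cos_le_one θ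
    have hs1' := Real.sin_le_one θ
    set c := Real.cos θ
    set s := Real.sin θ
    let Γ : Fin p → Fin p → ℝ := fun j k => ∑ i, ∫ ω, X i ω j * X i ω k ∂P
    let XX : Ω → Fin p → Fin p → ℝ := fun ω j k => ∑ i, X i ω j * X i ω k
    have hXXi : ∀ j k, Integrable (fun ω => XX ω j k) P := fun j k =>
      integrable_finsetSum _ fun i _ => integrable_coord_mul hX h3 i j k
    have hHi : ∀ j k, Integrable (fun z => hess g (W θ z) j k) Q := fun j k => by
      simpa using integrable_hess_comp_mul hβ g (hWm θ) (integrable_const (1 : ℝ)) (μ := Q) j k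
    have hHXi : ∀ j k, Integrable (fun z => hess g (W θ z) j k * XX z.1 j k) Q := fun j k =>
      integrable_hess_comp_mul hβ g (hWm θ) ((hXXi j k).comp_fst τ) j k
    have hT : ∀ j, ∫ z, z.2 j * grad g (W θ z) j ∂Q =
        ∑ k, c * (Γ j k * ∫ z, hess g (W θ z) j k ∂Q) := by
      intro j
      rw [integral_prod _ (integrable_mul_grad_comp g (hWm θ) (hx1 j) j)]
      have e1 : ∀ ω, ∫ x, x j * grad g (W θ (ω, x)) j ∂τ =
          ∑ k, c * (Γ j k * ∫ x, hess g (W θ (ω, x)) j k ∂τ) := fun ω => by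
        refine (integral_coord_mul_grad hβ h0 g (fun k => s * S ω k) c j).trans
          (Finset.sum_congr rfl fun k _ => ?_)
        rw [hcov]
        simp only [Γ, W]
        ring
      simp only [e1]
      rw [integral_finsetSum _ fun k _ =>
        ((hHi j k).integral_prod_left.const_mul (Γ j k)).const_mul c]
      refine Finset.sum_congr rfl fun k _ => ?_
      rw [integral_const_mul, integral_const_mul, ← integral_prod _ (hHi j k)]
    -- `D` is the quantity of the leave-one-out estimate, with the Gaussian part c · x held fixed as
    -- the shift `u`.
    let D : Ω × EuclideanSpace ℝ (Fin p) → ℝ := fun z =>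
      ∑ j, S z.1 j * grad g (W θ z) j - s * ∑ j, ∑ k, hess g (W θ z) j k * XX z.1 j k
    have hSgi : Integrable (fun z => ∑ j, S z.1 j * grad g (W θ z) j) Q :=
      integrable_finsetSum _ fun j _ => integrable_mul_grad_comp g (hWm θ) (hs1 j) j
    have hDi : Integrable D Q := hSgi.sub (Integrable.const_mul
      (integrable_finsetSum _ fun j _ => integrable_finsetSum _ fun k _ => hHXi j k) s)
    have hDM : |∫ z, D z ∂Q| ≤ M := by
      rw [integral_prod_symm _ hDi]
      have : ∀ x, ‖∫ ω, D (ω, x) ∂P‖ ≤ M := fun x =>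
        abs_integral_grad_sub_hess_le hβ hX hind hmean h3 g (fun k => c * x k) hs0 hs1'
      simpa using norm_integral_le_of_norm_le_const (μ := τ) (.of_forall this)
    -- `N` pairs the Hessian with the fluctuation of ∑ X_i X_iᵀ around its mean Γ, and is controlled
    -- by B₁.
    let N : Ω × EuclideanSpace ℝ (Fin p) → ℝ := fun z =>
      ∑ j, ∑ k, hess g (W θ z) j k * (XX z.1 j k - Γ j k)
    have hNi : Integrable N Q := integrable_finsetSum _ fun j _ => integrable_finsetSum _ fun k _ =>
      integrable_hess_comp_mul hβ g (hWm θ)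
        (((hXXi j k).comp_fst τ).sub (integrable_const _)) j k
    have hB1i : Integrable (fun ω => vecMax (fun jk : Fin p × Fin p =>
        |∑ i, (X i ω jk.1 * X i ω jk.2 - ∫ ω', X i ω' jk.1 * X i ω' jk.2 ∂P)|)) P :=
      integrable_vecMax (fun jk => (integrable_finsetSum _ fun i _ =>
        (integrable_coord_mul hX h3 i jk.1 jk.2).sub (integrable_const _)).abs)
        fun ω jk => abs_nonneg _
    have hNM : |∫ z, N z ∂Q| ≤ 5 * L * β * B1 P X := by
      have hpt : ∀ z, |N z| ≤ 5 * L * β * vecMax (fun jk : Fin p × Fin p =>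
          |∑ i, (X i z.1 jk.1 * X i z.1 jk.2 - ∫ ω', X i ω' jk.1 * X i ω' jk.2 ∂P)|) := by
        intro z
        let m := vecMax (fun jk : Fin p × Fin p =>
          |∑ i, (X i z.1 jk.1 * X i z.1 jk.2 - ∫ ω', X i ω' jk.1 * X i ω' jk.2 ∂P)|)
        have hm0 : 0 ≤ m := vecMax_nonneg fun jk => abs_nonneg _
        have hjk : ∀ j k, |XX z.1 j k - Γ j k| ≤ m := fun j k => by
          rw [show XX z.1 j k - Γ j k = ∑ i, (X i z.1 j * X i z.1 k -
            ∫ ω', X i ω' j * X i ω' k ∂P) from (Finset.sum_sub_distrib _ _).symm]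
          exact le_vecMax (fun jk : Fin p × Fin p =>
            |∑ i, (X i z.1 jk.1 * X i z.1 jk.2 - ∫ ω', X i ω' jk.1 * X i ω' jk.2 ∂P)|) (j, k)
        calc |N z| ≤ ∑ j, ∑ k, |hess g (W θ z) j k| * m := by
              refine (Finset.abs_sum_le_sum_abs _ _).trans (Finset.sum_le_sum fun j _ => ?_)
              refine (Finset.abs_sum_le_sum_abs _ _).trans (Finset.sum_le_sum fun k _ => ?_)
              rw [abs_mul]
              exact mul_le_mul_of_nonneg_left (hjk j k) (abs_nonneg _)
          _ = (∑ j, ∑ k, |hess g (W θ z) j k|) * m := by simp only [Finset.sum_mul]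
          _ ≤ _ := mul_le_mul_of_nonneg_right (sum_abs_hess_le hβ g _) hm0
      calc |∫ z, N z ∂Q| ≤ ∫ z, |N z| ∂Q := abs_integral_le_integral_abs
        _ ≤ ∫ z, 5 * L * β * vecMax (fun jk : Fin p × Fin p =>
            |∑ i, (X i z.1 jk.1 * X i z.1 jk.2 - ∫ ω', X i ω' jk.1 * X i ω' jk.2 ∂P)|) ∂Q :=
          integral_mono hNi.abs ((hB1i.comp_fst τ).const_mul _) hpt
        _ = _ := by
          rw [integral_const_mul, integral_fun_fst (f := fun ω =>
            vecMax (fun jk : Fin p × Fin p =>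
              |∑ i, (X i ω jk.1 * X i ω jk.2 - ∫ ω', X i ω' jk.1 * X i ω' jk.2 ∂P)|))]
          simp [B1]
    have hxg : Integrable (fun z => ∑ j, z.2 j * grad g (W θ z) j) Q :=
      integrable_finsetSum _ fun j _ => integrable_mul_grad_comp g (hWm θ) (hx1 j) j
    have hΓ : ∫ z, ∑ j, ∑ k, Γ j k * hess g (W θ z) j k ∂Q =
        ∑ j, ∑ k, Γ j k * ∫ z, hess g (W θ z) j k ∂Q := by
      rw [integral_finsetSum _ fun j _ => integrable_finsetSum _ fun k _ => (hHi j k).const_mul _]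
      refine Finset.sum_congr rfl fun j _ => ?_
      rw [integral_finsetSum _ fun k _ => (hHi j k).const_mul _]
      exact Finset.sum_congr rfl fun k _ => integral_const_mul _ _
    have hΓi : Integrable (fun z => ∑ j, ∑ k, Γ j k * hess g (W θ z) j k) Q :=
      integrable_finsetSum _ fun j _ => integrable_finsetSum _ fun k _ => (hHi j k).const_mul _
    have hxg' : ∫ z, ∑ j, z.2 j * grad g (W θ z) j ∂Q =
        c * ∫ z, ∑ j, ∑ k, Γ j k * hess g (W θ z) j k ∂Q := by
      rw [hΓ, integral_finsetSum _ fun j _ => integrable_mul_grad_comp g (hWm θ) (hx1 j) j]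
      simp only [hT, Finset.mul_sum]
    -- The last bracket integrates to zero: Gaussian integration by parts (`hxg'`) turns x · grad
    -- into c times the pairing of Γ with the Hessian. Matching covariances are used exactly here.
    have hsplit : ∀ z, ∑ j, grad g (W θ z) j * V θ z j =
        c * D z + (s * c * N z + (s * c * ∑ j, ∑ k, Γ j k * hess g (W θ z) j k -
          s * ∑ j, z.2 j * grad g (W θ z) j)) := by
      intro z
      have e1 : ∑ j, grad g (W θ z) j * V θ z j =
          c * ∑ j, S z.1 j * grad g (W θ z) j - s * ∑ j, z.2 j * grad g (W θ z) j := by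
        rw [Finset.mul_sum, Finset.mul_sum, ← Finset.sum_sub_distrib]
        exact Finset.sum_congr rfl fun j _ => by simp only [V]; ring
      have e2 : N z = ∑ j, ∑ k, hess g (W θ z) j k * XX z.1 j k -
          ∑ j, ∑ k, Γ j k * hess g (W θ z) j k := by
        simp only [N, mul_sub, Finset.sum_sub_distrib, mul_comm (Γ _ _)]
      rw [e1, e2]
      simp only [D]
      ring
    have htot : ∫ z, ∑ j, grad g (W θ z) j * V θ z j ∂Q =
        c * ∫ z, D z ∂Q + s * c * ∫ z, N z ∂Q := by
      simp only [hsplit]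
      have i1 : Integrable (fun z => s * c * ∑ j, ∑ k, Γ j k * hess g (W θ z) j k -
          s * ∑ j, z.2 j * grad g (W θ z) j) Q := (hΓi.const_mul (s * c)).sub (hxg.const_mul s)
      have i2 : Integrable (fun z => s * c * N z + (s * c * ∑ j, ∑ k, Γ j k * hess g (W θ z) j k -
          s * ∑ j, z.2 j * grad g (W θ z) j)) Q := (hNi.const_mul (s * c)).add i1
      rw [integral_add (hDi.const_mul c) i2, integral_add (hNi.const_mul (s * c)) i1,
        integral_sub (hΓi.const_mul (s * c)) (hxg.const_mul s)]
      simp only [integral_const_mul, hxg']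
      ring
    rw [htot]
    refine (abs_add_le _ _).trans (add_le_add ?_ ?_)
    · rw [abs_mul, abs_of_nonneg hc0]
      exact (mul_le_of_le_one_left (abs_nonneg _) hc1).trans hDM
    · rw [abs_mul, abs_of_nonneg (mul_nonneg hs0 hc0)]
      exact (mul_le_of_le_one_left (abs_nonneg _) (mul_le_one₀ hs1' hc0 hc1)).trans hNM
  have hmv := Convex.norm_image_sub_le_of_norm_hasDerivWithin_le (x := 0) (y := Real.pi / 2)
    (fun θ _ => (hD θ).hasDerivWithinAt) hbound (convex_Icc (0 : ℝ) (Real.pi / 2))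
    ⟨le_rfl, by positivity⟩ ⟨by positivity, le_rfl⟩
  have e1 : ∫ z, g.toFun (lse β (W (Real.pi / 2) z)) ∂Q = ∫ ω, g.toFun (lse β (S ω)) ∂P := by
    have := integral_fun_fst (μ := P) (ν := τ) (f := fun ω => g.toFun (lse β (S ω)))
    simp only [probReal_univ, one_smul] at this
    rw [← this]
    simp [W]
    rfl
  have e2 : ∫ z, g.toFun (lse β (W 0 z)) ∂Q = ∫ x, g.toFun (lse β fun j => x j) ∂τ := by
    have := integral_fun_snd (μ := P) (ν := τ)
      (f := fun x : EuclideanSpace ℝ (Fin p) => g.toFun (lse β fun j => x j))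
    simp only [probReal_univ, one_smul] at this
    rw [← this]
    simp [W]
    rfl
  rw [e1, e2] at hmv
  simpa [abs_of_pos Real.pi_pos] using hmv

end Interpolation

/-! ### Strassen's theorem on a finite set -/

section FiniteStrassen

variable {K : Type*} [Fintype K] [DecidableEq K] {μ ν : K → ℝ} {R : K → K → Prop}

/-- A partial transport plan supported on a relation, obtained from Hall's marriage theorem. -/
theorem exists_partial_transport [DecidableRel R] (hμ : ∀ x, 0 ≤ μ x) (hν : ∀ x, 0 ≤ ν x)
    (hμ1 : ∑ x, μ x = 1) {Δ η : ℝ} (hΔ : 0 ≤ Δ) (hη : 0 < η)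
    (h : ∀ A : Finset K,
      ∑ x ∈ A, μ x ≤ ∑ y ∈ Finset.univ.filter (fun y => ∃ x ∈ A, R x y), ν y + Δ) :
    ∃ m : K → K → ℝ, (∀ x y, 0 ≤ m x y) ∧ (∀ x, ∑ y, m x y ≤ μ x) ∧ (∀ y, ∑ x, m x y ≤ ν y) ∧
      (∀ x y, ¬ R x y → m x y = 0) ∧ 1 - Δ - η ≤ ∑ x, ∑ y, m x y := by
  -- Masses are cut into units of size 1/N. Rounding down loses at most |K| units of μ and |K| of ν,
  -- and rounding NΔ up adds at most one; their total is below Nη.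
  obtain ⟨N, hN⟩ := exists_nat_gt ((2 * Fintype.card K + 1) / η)
  have hN0 : (0 : ℝ) < N := lt_of_le_of_lt (by positivity) hN
  let a : K → ℕ := fun x => ⌊N * μ x⌋₊
  let b : K → ℕ := fun x => ⌊N * ν x⌋₊
  -- The number of jokers, which may be matched with any unit of μ. They make up for the deficit Δ
  -- and for the rounding of ν, so that Hall's condition holds; units matched to jokers are later
  -- discarded.
  let D : ℕ := ⌈N * Δ⌉₊ + Fintype.card K
  have ha : ∀ x, (a x : ℝ) ≤ N * μ x := fun x => Nat.floor_le (mul_nonneg hN0.le (hμ x))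
  have ha' : ∀ x, N * μ x ≤ a x + 1 := fun x => (Nat.lt_floor_add_one _).le
  have hb : ∀ x, (b x : ℝ) ≤ N * ν x := fun x => Nat.floor_le (mul_nonneg hN0.le (hν x))
  have hb' : ∀ x, N * ν x ≤ b x + 1 := fun x => (Nat.lt_floor_add_one _).le
  let t : (Σ x, Fin (a x)) → Finset ((Σ y, Fin (b y)) ⊕ Fin D) := fun l =>
    Finset.disjSum ((Finset.univ.filter (R l.1)).sigma fun _ => Finset.univ) Finset.univ
  have hall : ∀ s : Finset (Σ x, Fin (a x)), s.card ≤ (s.biUnion t).card := by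
    intro s
    rcases s.eq_empty_or_nonempty with rfl | ⟨l₀, hl₀⟩
    · simp
    let A := s.image Sigma.fst
    let NA := Finset.univ.filter (fun y => ∃ x ∈ A, R x y)
    have h1 : s.card ≤ ∑ x ∈ A, a x := by
      have : s ⊆ A.sigma fun _ => Finset.univ := fun l hl =>
        Finset.mem_sigma.2 ⟨Finset.mem_image_of_mem _ hl, Finset.mem_univ _⟩
      simpa using Finset.card_le_card this
    have h2 : ∑ y ∈ NA, b y + D ≤ (s.biUnion t).card := by
      have : Finset.disjSum (NA.sigma fun _ => Finset.univ) Finset.univ ⊆ s.biUnion t := by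
        intro r hr
        rw [Finset.mem_biUnion]
        rcases r with q | d
        · simp only [Finset.inl_mem_disjSum, Finset.mem_sigma, NA, Finset.mem_filter,
            Finset.mem_univ, true_and, and_true, A, Finset.mem_image] at hr
          obtain ⟨x, ⟨l, hl, rfl⟩, hR⟩ := hr
          exact ⟨l, hl, by simpa [t] using hR⟩
        · exact ⟨l₀, hl₀, by simp [t]⟩
      simpa [Finset.card_disjSum, Finset.card_sigma] using Finset.card_le_card this
    refine h1.trans (le_trans ?_ h2)
    have h3 : (∑ x ∈ A, a x : ℝ) ≤ ∑ y ∈ NA, (b y : ℝ) + D := by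
      calc (∑ x ∈ A, a x : ℝ) ≤ ∑ x ∈ A, N * μ x := Finset.sum_le_sum fun x _ => ha x
        _ = N * ∑ x ∈ A, μ x := by rw [Finset.mul_sum]
        _ ≤ N * (∑ y ∈ NA, ν y + Δ) := mul_le_mul_of_nonneg_left (h A) hN0.le
        _ = ∑ y ∈ NA, N * ν y + N * Δ := by rw [mul_add, Finset.mul_sum]
        _ ≤ ∑ y ∈ NA, ((b y : ℝ) + 1) + ⌈N * Δ⌉₊ :=
          add_le_add (Finset.sum_le_sum fun y _ => hb' y) (Nat.le_ceil _)
        _ ≤ ∑ y ∈ NA, (b y : ℝ) + D := by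
          have : (NA.card : ℝ) ≤ Fintype.card K := by exact_mod_cast Finset.card_le_univ NA
          simp only [Finset.sum_add_distrib, Finset.sum_const, nsmul_eq_mul, mul_one, D]
          push_cast
          linarith
    exact_mod_cast h3
  obtain ⟨f, hf, hft⟩ := (Finset.all_card_le_biUnion_card_iff_exists_injective t).1 hall
  let pr : (Σ y, Fin (b y)) ⊕ Fin D → Option K := Sum.elim (fun q => some q.1) fun _ => none
  have hpr : ∀ l y, pr (f l) = some y → R l.1 y := by
    intro l y hy
    have := hft l
    rcases hfl : f l with q | d
    · rw [hfl] at this hy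
      simp only [pr, Sum.elim_inl, Option.some.injEq] at hy
      subst hy
      simpa [t] using this
    · rw [hfl] at hy
      simp [pr] at hy
  let cnt : K → K → ℕ := fun x y =>
    ∑ i : Fin (a x), if pr (f ⟨x, i⟩) = some y then 1 else 0
  have hrow : ∀ x, ∑ y, cnt x y ≤ a x := by
    intro x
    simp only [cnt]
    rw [Finset.sum_comm]
    calc _ ≤ ∑ _i : Fin (a x), 1 := Finset.sum_le_sum fun i _ => by
            rcases pr (f ⟨x, i⟩) with _ | y <;> simp
      _ = a x := by simp
  have hcol : ∀ y, ∑ x, cnt x y ≤ b y := by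
    intro y
    simp only [cnt]
    rw [← Fintype.sum_sigma' (fun x i => if pr (f ⟨x, i⟩) = some y then 1 else 0),
      ← Finset.card_filter]
    calc _ ≤ (Finset.univ.image fun q : Fin (b y) => (Sum.inl ⟨y, q⟩ :
            (Σ y, Fin (b y)) ⊕ Fin D)).card := by
          refine Finset.card_le_card_of_injOn f (fun l hl => ?_) hf.injOn
          rw [Finset.mem_coe, Finset.mem_filter] at hl
          have hl2 : pr (f l) = some y := hl.2
          rcases hfl : f l with q | d
          · rw [hfl] at hl2
            simp only [pr, Sum.elim_inl, Option.some.injEq] at hl2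
            subst hl2
            simp
          · rw [hfl] at hl2
            simp [pr] at hl2
      _ ≤ b y := Finset.card_image_le.trans (by simp)
  have htot : ∑ x, a x ≤ ∑ x, ∑ y, cnt x y + D := by
    have h1 : ∀ l : Σ x, Fin (a x), 1 =
        (∑ y, if pr (f l) = some y then 1 else 0) + if pr (f l) = none then 1 else 0 := by
      intro l
      rcases pr (f l) with _ | y <;> simp
    have h2 : (Finset.univ.filter fun l => pr (f l) = none).card ≤ D := by
      calc _ ≤ (Finset.univ.image (Sum.inr : Fin D → (Σ y, Fin (b y)) ⊕ Fin D)).card := by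
            refine Finset.card_le_card_of_injOn f (fun l hl => ?_) hf.injOn
            rw [Finset.mem_coe, Finset.mem_filter] at hl
            have hl2 := hl.2
            rcases hfl : f l with q | d
            · rw [hfl] at hl2
              simp [pr] at hl2
            · simp
        _ ≤ D := Finset.card_image_le.trans (by simp)
    have h3 : ∑ x, a x = Fintype.card (Σ x, Fin (a x)) := by simp
    have h4 : Fintype.card (Σ x, Fin (a x)) = ∑ _l : Σ x, Fin (a x), 1 := by simp
    have h5 : ∑ l : Σ x, Fin (a x), (∑ y, if pr (f l) = some y then 1 else 0) =
        ∑ x, ∑ y, cnt x y := by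
      rw [Fintype.sum_sigma]
      exact Finset.sum_congr rfl fun x _ => Finset.sum_comm
    rw [h3, h4, Finset.sum_congr rfl fun l _ => h1 l, Finset.sum_add_distrib, h5,
      ← Finset.card_filter]
    exact Nat.add_le_add_left h2 _
  refine ⟨fun x y => cnt x y / N, fun x y => by positivity, fun x => ?_, fun y => ?_,
    fun x y hxy => ?_, ?_⟩
  · rw [← Finset.sum_div, div_le_iff₀ hN0, mul_comm]
    refine le_trans ?_ (ha x)
    exact_mod_cast hrow x
  · rw [← Finset.sum_div, div_le_iff₀ hN0, mul_comm]
    refine le_trans ?_ (hb y)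
    exact_mod_cast hcol y
  · have : cnt x y = 0 := Finset.sum_eq_zero fun i _ =>
      if_neg fun hy => hxy (hpr ⟨x, i⟩ y hy)
    simp [this]
  · simp only [← Finset.sum_div]
    rw [le_div_iff₀ hN0]
    have h1 : (∑ x, a x : ℝ) ≤ ∑ x, ∑ y, (cnt x y : ℝ) + D := by exact_mod_cast htot
    have h2 : (N : ℝ) ≤ ∑ x, (a x : ℝ) + Fintype.card K := by
      calc (N : ℝ) = ∑ x, N * μ x := by rw [← Finset.mul_sum, hμ1, mul_one]
        _ ≤ ∑ x, ((a x : ℝ) + 1) := Finset.sum_le_sum fun x _ => ha' x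
        _ = _ := by simp [Finset.sum_add_distrib]
    have h3 : (D : ℝ) ≤ N * Δ + 1 + Fintype.card K := by
      have := (Nat.ceil_lt_add_one (mul_nonneg hN0.le hΔ)).le
      simp only [D]
      push_cast
      linarith
    have h4 : 2 * (Fintype.card K : ℝ) + 1 ≤ N * η := ((div_lt_iff₀ hη).1 hN).le
    linarith

/-- Strassen's theorem on a finite set, up to an arbitrarily small loss. -/
theorem exists_transport [DecidableRel R] (hμ : ∀ x, 0 ≤ μ x) (hν : ∀ x, 0 ≤ ν x)
    (hμ1 : ∑ x, μ x = 1) (hν1 : ∑ x, ν x = 1) {Δ η : ℝ} (hΔ : 0 ≤ Δ) (hη : 0 < η)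
    (h : ∀ A : Finset K,
      ∑ x ∈ A, μ x ≤ ∑ y ∈ Finset.univ.filter (fun y => ∃ x ∈ A, R x y), ν y + Δ) :
    ∃ w : K → K → ℝ, (∀ x y, 0 ≤ w x y) ∧ (∀ x, ∑ y, w x y = μ x) ∧ (∀ y, ∑ x, w x y = ν y) ∧
      ∑ x, ∑ y, (if R x y then 0 else w x y) ≤ Δ + η := by
  obtain ⟨m, hm0, hrow, hcol, hR, htot⟩ := exists_partial_transport hμ hν hμ1 hΔ hη h
  set ρ := 1 - ∑ x, ∑ y, m x y with hρ
  let r : K → ℝ := fun x => μ x - ∑ y, m x y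
  let c : K → ℝ := fun y => ν y - ∑ x, m x y
  have hr0 : ∀ x, 0 ≤ r x := fun x => sub_nonneg.2 (hrow x)
  have hc0 : ∀ x, 0 ≤ c x := fun x => sub_nonneg.2 (hcol x)
  have hrs : ∑ x, r x = ρ := by simp only [r, Finset.sum_sub_distrib, hμ1, hρ]
  have hcs : ∑ x, c x = ρ := by
    simp only [c, Finset.sum_sub_distrib, hν1, hρ]
    rw [Finset.sum_comm]
  have hρ0 : 0 ≤ ρ := hrs ▸ Finset.sum_nonneg fun x _ => hr0 x
  -- The residual masses `r` and `c`, both of total ρ, are joined by the product plan r c / ρ. If ρ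
  -- = 0 they vanish, and division by zero gives the correct value 0.
  have hcancel : ∀ z : ℝ, 0 ≤ z → z ≤ ρ → z * ρ / ρ = z := by
    intro z hz hzρ
    rcases hρ0.eq_or_lt with h0 | h0
    · rw [← h0] at hzρ ⊢
      rw [le_antisymm hzρ hz]
      simp
    · field_simp
  have hrle : ∀ x, r x ≤ ρ := fun x => hrs ▸
    Finset.single_le_sum (fun x _ => hr0 x) (Finset.mem_univ x)
  have hcle : ∀ x, c x ≤ ρ := fun x => hcs ▸
    Finset.single_le_sum (fun x _ => hc0 x) (Finset.mem_univ x)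
  refine ⟨fun x y => m x y + r x * c y / ρ, fun x y => ?_, fun x => ?_, fun y => ?_, ?_⟩
  · exact add_nonneg (hm0 x y) (div_nonneg (mul_nonneg (hr0 x) (hc0 y)) hρ0)
  · rw [Finset.sum_add_distrib, ← Finset.sum_div, ← Finset.mul_sum, hcs,
      hcancel _ (hr0 x) (hrle x)]
    simp [r]
  · rw [Finset.sum_add_distrib, ← Finset.sum_div, ← Finset.sum_mul, hrs, mul_comm,
      hcancel _ (hc0 y) (hcle y)]
    simp [c]
  · calc _ ≤ ∑ x, ∑ y, r x * c y / ρ := by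
          refine Finset.sum_le_sum fun x _ => Finset.sum_le_sum fun y _ => ?_
          split_ifs with hxy
          · exact div_nonneg (mul_nonneg (hr0 x) (hc0 y)) hρ0
          · simp only [hR x y hxy, zero_add, le_refl]
      _ = ρ := by
          simp only [← Finset.sum_div, ← Finset.mul_sum, hcs, ← Finset.sum_mul, hrs]
          exact hcancel ρ hρ0 le_rfl
      _ ≤ Δ + η := by linarith

end FiniteStrassen

/-! ### Realizing a finite transport plan with a uniform variable -/

section Randomization

variable {Ω : Type*} [MeasurableSpace Ω] {P : Measure Ω}

lemma map_projIcc_of_isUniform {U : Ω → ℝ} (hU : Measurable U)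
    (hUu : pdf.IsUniform U (Set.Ioo 0 1) P) :
    P.map (fun ω => Set.projIcc (0 : ℝ) 1 zero_le_one (U ω)) =
      (volume : Measure unitInterval) := by
  have hp : Measurable (Set.projIcc (0 : ℝ) 1 zero_le_one) := continuous_projIcc.measurable
  have h1 : P.map U = (volume : Measure ℝ).restrict (Set.Icc 0 1) := by
    rw [show P.map U = ProbabilityTheory.cond volume (Set.Ioo (0 : ℝ) 1) from hUu,
      ProbabilityTheory.cond, Real.volume_Ioo, Measure.restrict_congr_set Ioo_ae_eq_Icc]
    simp
  have h2 : (volume : Measure ℝ).restrict (Set.Icc 0 1) =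
      (volume : Measure unitInterval).map Subtype.val :=
    (map_comap_subtype_coe measurableSet_Icc volume).symm
  refine (Measure.map_map hp hU).symm.trans ?_
  rw [h1, h2, Measure.map_map hp measurable_subtype_coe]
  have : Set.projIcc (0 : ℝ) 1 zero_le_one ∘ Subtype.val = id :=
    funext fun x => Set.projIcc_val zero_le_one x
  rw [this, Measure.map_id]

/-- Realization of a coupling specified by transport weights between the cells of a finite
partition of the line. -/
theorem exists_randomization [IsProbabilityMeasure P] {K : Type*} [Fintype K] [DecidableEq K] [MeasurableSpace K]
    [MeasurableSingletonClass K] {Z U : Ω → ℝ} (hZ : Measurable Z) (hU : Measurable U)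
    (hUu : pdf.IsUniform U (Set.Ioo 0 1) P) (hind : IndepFun Z U P) (ν : Measure ℝ)
    [IsProbabilityMeasure ν] {c : ℝ → K} (hc : Measurable c) {w : K → K → ℝ}
    (hw0 : ∀ x y, 0 ≤ w x y) (hrow : ∀ x, ∑ y, w x y = P.real {ω | c (Z ω) = x})
    (hcol : ∀ y, ∑ x, w x y = ν.real (c ⁻¹' {y})) :
    ∃ Zt : Ω → ℝ, Measurable Zt ∧ P.map Zt = ν ∧
      ∀ x y, P.real {ω | c (Z ω) = x ∧ c (Zt ω) = y} ≤ w x y := by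
  have hcell : ∀ y, MeasurableSet (c ⁻¹' {y}) := fun y => hc (measurableSet_singleton y)
  -- The conditional law of the new variable given that `Z` lies in cell x: choose a cell y with
  -- probability w x y / μ x, then a point of it according to ν. For null cells x the choice `ν`
  -- only keeps `κ x` a probability measure; for ν-null cells y the conditional measure is zero, and
  -- so is the weight.
  let κ : K → Measure ℝ := fun x =>
    if P.real {ω | c (Z ω) = x} = 0 then ν else
      ∑ y, ENNReal.ofReal (w x y / P.real {ω | c (Z ω) = x}) • ν[|c ⁻¹' {y}]
  have hwν : ∀ x y, ν.real (c ⁻¹' {y}) = 0 → w x y = 0 := fun x y h =>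
    (Finset.sum_eq_zero_iff_of_nonneg fun x _ => hw0 x y).1 ((hcol y).trans h) x (Finset.mem_univ x)
  have hwμ : ∀ x y, P.real {ω | c (Z ω) = x} = 0 → w x y = 0 := fun x y h =>
    (Finset.sum_eq_zero_iff_of_nonneg fun y _ => hw0 x y).1 ((hrow x).trans h) y (Finset.mem_univ y)
  have hκreal : ∀ x (E : Set ℝ), P.real {ω | c (Z ω) = x} * (κ x).real E =
      ∑ y, w x y * (ν[|c ⁻¹' {y}]).real E := by
    intro x E
    by_cases hx : P.real {ω | c (Z ω) = x} = 0
    · rw [hx, zero_mul]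
      exact (Finset.sum_eq_zero fun y _ => by rw [hwμ x y hx, zero_mul]).symm
    · simp only [κ, if_neg hx]
      have ha0 : 0 ≤ P.real {ω | c (Z ω) = x} := measureReal_nonneg
      generalize P.real {ω | c (Z ω) = x} = a at hx ha0 ⊢
      rw [measureReal_def, Measure.finsetSum_apply, ENNReal.toReal_sum, Finset.mul_sum]
      · refine Finset.sum_congr rfl fun y _ => ?_
        rw [Measure.smul_apply, smul_eq_mul, ENNReal.toReal_mul,
          ENNReal.toReal_ofReal (div_nonneg (hw0 x y) ha0), ← measureReal_def]
        field_simp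
      · intro y _
        rw [Measure.smul_apply, smul_eq_mul]
        exact ENNReal.mul_ne_top ENNReal.ofReal_ne_top (measure_ne_top _ _)
  have hcond : ∀ y, ν.real (c ⁻¹' {y}) ≠ 0 → IsProbabilityMeasure (ν[|c ⁻¹' {y}]) := fun y hy =>
    cond_isProbabilityMeasure fun h => hy (by rw [measureReal_def, h, ENNReal.toReal_zero])
  have hκp : ∀ x, IsProbabilityMeasure (κ x) := by
    intro x
    by_cases hx : P.real {ω | c (Z ω) = x} = 0
    · simp only [κ, if_pos hx]
      infer_instance
    · constructor
      have h1 : P.real {ω | c (Z ω) = x} * (κ x).real Set.univ = P.real {ω | c (Z ω) = x} := by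
        rw [hκreal]
        conv_rhs => rw [← hrow x]
        refine Finset.sum_congr rfl fun y _ => ?_
        by_cases hy : ν.real (c ⁻¹' {y}) = 0
        · rw [hwν x y hy, zero_mul]
        · have := hcond y hy
          rw [probReal_univ, mul_one]
      have h2 : (κ x).real Set.univ = 1 := mul_left_cancel₀ hx (by rw [h1, mul_one])
      rw [measureReal_def] at h2
      rw [← ENNReal.toReal_eq_one_iff, h2]
  -- Every `κ x` is an image of Lebesgue measure on the unit interval, so a uniform variable
  -- independent of `Z` can sample from it.
  choose G hGm hGκ using fun x =>
    have := hκp x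
    Measure.exists_measurable_map_eq (κ x)
  let V : Ω → unitInterval := fun ω => Set.projIcc (0 : ℝ) 1 zero_le_one (U ω)
  have hVm : Measurable V := continuous_projIcc.measurable.comp hU
  have hVvol : P.map V = volume := map_projIcc_of_isUniform hU hUu
  have hcZV : IndepFun (fun ω => c (Z ω)) V P :=
    hind.comp hc (continuous_projIcc (h := zero_le_one)).measurable
  let Zt : Ω → ℝ := fun ω => G (c (Z ω)) (V ω)
  have hGm2 : Measurable (fun q : K × unitInterval => G q.1 q.2) :=
    measurable_from_prod_countable_right hGm
  have hZt : Measurable Zt := hGm2.comp ((hc.comp hZ).prodMk hVm)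
  have hjoint : ∀ x {E : Set ℝ}, MeasurableSet E →
      P.real {ω | c (Z ω) = x ∧ Zt ω ∈ E} = ∑ y, w x y * (ν[|c ⁻¹' {y}]).real E := by
    intro x E hE
    have e1 : {ω | c (Z ω) = x ∧ Zt ω ∈ E} =
        (fun ω => c (Z ω)) ⁻¹' {x} ∩ V ⁻¹' (G x ⁻¹' E) := by
      ext ω
      simp only [Zt, Set.mem_ofPred_eq, Set.mem_inter_iff, Set.mem_preimage, Set.mem_singleton_iff]
      constructor
      · rintro ⟨rfl, h⟩
        exact ⟨rfl, h⟩
      · rintro ⟨rfl, h⟩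
        exact ⟨rfl, h⟩
    rw [← hκreal, e1, measureReal_def, hcZV.measure_inter_preimage_eq_mul _ _
      (measurableSet_singleton x) (hGm x hE), ENNReal.toReal_mul, ← Measure.map_apply hVm (hGm x hE),
      hVvol, ← Measure.map_apply (hGm x) hE, hGκ]
    rfl
  have hset : ∀ x, MeasurableSet {ω | c (Z ω) = x} := fun x =>
    (hc.comp hZ) (measurableSet_singleton x)
  refine ⟨Zt, hZt, ?_, fun x y => ?_⟩
  · have : IsProbabilityMeasure (P.map Zt) := Measure.isProbabilityMeasure_map hZt.aemeasurable
    refine Measure.ext fun E hE => (ENNReal.toReal_eq_toReal_iff' (measure_ne_top _ _)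
      (measure_ne_top _ _)).1 ?_
    change (P.map Zt).real E = ν.real E
    have hEZ : MeasurableSet (Zt ⁻¹' E) := hZt hE
    rw [map_measureReal_apply hZt hE]
    have e1 : P.real (Zt ⁻¹' E) = ∑ x, P.real {ω | c (Z ω) = x ∧ Zt ω ∈ E} := by
      rw [← measureReal_biUnion_finset]
      · congr 1
        ext ω
        simp
      · intro x _ x' _ hxx'
        exact Set.disjoint_left.2 fun ω h1 h2 => hxx' (h1.1.symm.trans h2.1)
      · exact fun x _ => (hset x).inter hEZ
    have e2 : ν.real E = ∑ y, ν.real (c ⁻¹' {y}) * (ν[|c ⁻¹' {y}]).real E := by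
      have h1 : ∀ y, ν.real (c ⁻¹' {y}) * (ν[|c ⁻¹' {y}]).real E =
          ν.real (c ⁻¹' {y} ∩ E) := fun y => by
        rw [mul_comm, measureReal_def, measureReal_def, ← ENNReal.toReal_mul,
          cond_mul_eq_inter (hcell y), measureReal_def]
      simp only [h1]
      rw [← measureReal_biUnion_finset]
      · congr 1
        ext z
        simp
      · intro x _ x' _ hxx'
        exact Set.disjoint_left.2 fun ω h1 h2 => hxx' (h1.1.symm.trans h2.1)
      · exact fun y _ => (hcell y).inter hE
    rw [e1, e2]
    simp only [hjoint _ hE]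
    rw [Finset.sum_comm]
    simp only [← Finset.sum_mul, hcol]
  · refine (hjoint x (hcell y)).trans_le ?_
    rw [Finset.sum_eq_single y]
    · exact mul_le_of_le_one_right (hw0 x y) measureReal_le_one
    · intro y' _ hy'
      have : c ⁻¹' {y'} ∩ c ⁻¹' {y} = ∅ := by
        ext z
        simp only [Set.mem_inter_iff, Set.mem_preimage, Set.mem_singleton_iff,
          Set.mem_empty_iff_false, iff_false, not_and]
        rintro rfl
        exact hy'
      rw [measureReal_def, cond_apply (hcell y'), this]
      simp
    · simp

end Randomization

/-! ### Strassen's theorem on the line through a grid -/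

section Coupling

/-- Index of the cell of mesh `d` containing `z`; the two extreme cells are unbounded. -/
noncomputable def gridCell (T d : ℝ) (N : ℕ) (z : ℝ) : Fin (N + 1) :=
  ⟨min ⌊(z + T) / d⌋₊ N, Nat.lt_succ_of_le (min_le_right _ _)⟩

lemma measurable_gridCell (T d : ℝ) (N : ℕ) : Measurable (gridCell T d N) := by
  have h1 : Measurable fun z : ℝ => ⌊(z + T) / d⌋₊ :=
    Nat.measurable_floor.comp ((measurable_id.add_const T).div_const d)
  exact (measurable_from_top (f := fun k : ℕ =>
    (⟨min k N, Nat.lt_succ_of_le (min_le_right _ _)⟩ : Fin (N + 1)))).comp h1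

/-- A positive index excludes the truncation of the natural floor at 0, and an index below `N`
excludes the cap, so the points share a true cell of length `d`. -/
lemma abs_sub_le_of_gridCell_eq {T d : ℝ} {N : ℕ} (hd : 0 < d) {s t : ℝ}
    (h : gridCell T d N s = gridCell T d N t) (h0 : 0 < (gridCell T d N s).1)
    (hN : (gridCell T d N s).1 < N) : |s - t| ≤ d := by
  have h' : min ⌊(s + T) / d⌋₊ N = min ⌊(t + T) / d⌋₊ N := congrArg Fin.val h
  change 0 < min ⌊(s + T) / d⌋₊ N at h0
  change min ⌊(s + T) / d⌋₊ N < N at hN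
  have e : ⌊(s + T) / d⌋₊ = ⌊(t + T) / d⌋₊ := by omega
  have hs : 0 < ⌊(s + T) / d⌋₊ := by omega
  have ht : 0 < ⌊(t + T) / d⌋₊ := by omega
  have hs1 := Nat.floor_le (Nat.pos_of_floor_pos hs).le
  have ht1 := Nat.floor_le (Nat.pos_of_floor_pos ht).le
  have hs2 := Nat.lt_floor_add_one ((s + T) / d)
  have ht2 := Nat.lt_floor_add_one ((t + T) / d)
  rw [e] at hs1 hs2
  have h3 : |(s + T) / d - (t + T) / d| ≤ 1 := by
    rw [abs_le]
    constructor <;> linarith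
  have h4 : (s + T) / d - (t + T) / d = (s - t) / d := by ring
  rw [h4, abs_div, abs_of_pos hd, div_le_one hd] at h3
  exact h3

/-- The offset M + d rather than M reserves cell 0 for the lower tail. -/
lemma gridCell_interior {M d : ℝ} {N : ℕ} (hd : 0 < d) (hN : (2 * M + d) / d < N) {z : ℝ}
    (hz : z ∈ Set.Icc (-M) M) :
    0 < (gridCell (M + d) d N z).1 ∧ (gridCell (M + d) d N z).1 < N := by
  have h1 : 1 ≤ (z + (M + d)) / d := by
    rw [le_div_iff₀ hd]
    linarith [hz.1]
  have h2 : (z + (M + d)) / d < N := by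
    refine lt_of_le_of_lt ((div_le_div_iff_of_pos_right hd).2 ?_) hN
    linarith [hz.2]
  have h3 : 1 ≤ ⌊(z + (M + d)) / d⌋₊ := (Nat.one_le_floor_iff _).2 h1
  have h4 : ⌊(z + (M + d)) / d⌋₊ < N := (Nat.floor_lt (zero_le_one.trans h1)).2 h2
  change 0 < min _ N ∧ min _ N < N
  omega

lemma exists_measureReal_compl_Icc_le (μ : Measure ℝ) [IsFiniteMeasure μ] {η : ℝ} (hη : 0 < η) :
    ∃ M : ℝ, μ.real (Set.Icc (-M) M)ᶜ ≤ η := by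
  obtain ⟨K, -, hK, hlt⟩ := MeasurableSet.univ.exists_isCompact_lt_add (μ := μ)
    (measure_ne_top μ _) (ε := ENNReal.ofReal η) (by simpa using hη)
  obtain ⟨M, hM⟩ := hK.isBounded.subset_closedBall 0
  rw [Real.closedBall_eq_Icc, zero_sub, zero_add] at hM
  refine ⟨M, ?_⟩
  rw [measureReal_compl measurableSet_Icc]
  have h1 : μ.real Set.univ ≤ μ.real K + η := by
    have := (ENNReal.toReal_le_toReal (measure_ne_top μ _) (by finiteness)).2 hlt.le
    rwa [ENNReal.toReal_add (measure_ne_top μ _) ENNReal.ofReal_ne_top,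
      ENNReal.toReal_ofReal hη.le] at this
  have h2 : μ.real K ≤ μ.real (Set.Icc (-M) M) := measureReal_mono hM
  linarith

variable {Ω : Type*} [MeasurableSpace Ω] {P : Measure Ω} [IsProbabilityMeasure P]

/-- Coupling obtained from a finite partition of the line whose cells of index in `I` have diameter
at most `d`. -/
theorem exists_coupling_of_partition {Z U : Ω → ℝ} (hZ : Measurable Z) (hU : Measurable U)
    (hUu : pdf.IsUniform U (Set.Ioo 0 1) P) (hind : IndepFun Z U P) (ν : Measure ℝ)
    [IsProbabilityMeasure ν] {r Δ : ℝ} (hΔ : 0 ≤ Δ)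
    (h : ∀ B D : Set ℝ, MeasurableSet B → MeasurableSet D →
      (∀ s ∈ B, ∀ t, |s - t| ≤ r → t ∈ D) → P.real (Z ⁻¹' B) ≤ ν.real D + Δ)
    {d η : ℝ} (hη : 0 < η) {K : Type*} [Fintype K] [MeasurableSpace K]
    [MeasurableSingletonClass K] {c : ℝ → K} (hc : Measurable c) {I : Set K}
    (hclose : ∀ s t, c s = c t → c s ∈ I → |s - t| ≤ d)
    (htail : P.real (Z ⁻¹' (c ⁻¹' I)ᶜ) + ν.real (c ⁻¹' I)ᶜ ≤ η / 2) :
    ∃ Zt : Ω → ℝ, Measurable Zt ∧ P.map Zt = ν ∧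
      P.real {ω | |Z ω - Zt ω| > r + 2 * d} ≤ Δ + η := by
  classical
  have hcS : ∀ S : Set K, MeasurableSet (c ⁻¹' S) := fun S => hc S.to_countable.measurableSet
  -- Good cells that contain points within `r` of each other. Passing to arbitrary points of these
  -- cells costs one diameter `d` on each side.
  let R : K → K → Prop := fun x y =>
    x ∈ I ∧ y ∈ I ∧ ∃ s t, c s = x ∧ c t = y ∧ |s - t| ≤ r
  have hRd : ∀ s t, R (c s) (c t) → |s - t| ≤ r + 2 * d := by
    rintro s t ⟨hs, ht, s', t', hs', ht', hst⟩
    have h1 := abs_le.1 (hclose s s' hs'.symm hs)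
    have h2 := abs_le.1 (hclose t t' ht'.symm ht)
    have h3 := abs_le.1 hst
    rw [abs_le]
    constructor <;> linarith [h1.1, h1.2, h2.1, h2.2, h3.1, h3.2]
  let μ' : K → ℝ := fun x => P.real {ω | c (Z ω) = x}
  let ν' : K → ℝ := fun y => ν.real (c ⁻¹' {y})
  have hμs : ∀ A : Finset (K), ∑ x ∈ A, μ' x = P.real (Z ⁻¹' (c ⁻¹' A)) := fun A =>
    sum_measureReal_preimage_singleton A (f := fun ω => c (Z ω))
      fun x _ => (hc.comp hZ) (measurableSet_singleton x)
  have hνs : ∀ A : Finset (K), ∑ y ∈ A, ν' y = ν.real (c ⁻¹' A) := fun A =>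
    sum_measureReal_preimage_singleton A fun y _ => hc (measurableSet_singleton y)
  have hhall : ∀ A : Finset (K), ∑ x ∈ A, μ' x ≤
      ∑ y ∈ Finset.univ.filter (fun y => ∃ x ∈ A, R x y), ν' y + (Δ + η / 2) := by
    intro A
    rw [hμs, hνs]
    set NA := Finset.univ.filter (fun y => ∃ x ∈ A, R x y) with hNA
    -- A neighbour of a good cell lies in a related cell or in a bad one. The bad cells cost η/2 in
    -- all; the other half of η pays for the finite transport.
    have h1 := h (c ⁻¹' A ∩ c ⁻¹' I) (c ⁻¹' NA ∪ (c ⁻¹' I)ᶜ) ((hcS _).inter (hcS _))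
      ((hcS _).union (hcS _).compl) (fun s hs t hst => by
        by_cases ht : c t ∈ I
        · refine Or.inl ?_
          rw [Set.mem_preimage, Finset.mem_coe, hNA, Finset.mem_filter]
          exact ⟨Finset.mem_univ _, c s, hs.1, hs.2, ht, s, t, rfl, rfl, hst⟩
        · exact Or.inr ht)
    have h2 : P.real (Z ⁻¹' (c ⁻¹' A)) ≤
        P.real (Z ⁻¹' (c ⁻¹' A ∩ c ⁻¹' I)) + P.real (Z ⁻¹' (c ⁻¹' I)ᶜ) := by
      refine (measureReal_mono ?_).trans (measureReal_union_le _ _)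
      intro ω hω
      by_cases hI : c (Z ω) ∈ I
      · exact Or.inl ⟨hω, hI⟩
      · exact Or.inr hI
    have h3 := measureReal_union_le (μ := ν) (c ⁻¹' NA) (c ⁻¹' I)ᶜ
    linarith
  obtain ⟨w, hw0, hrow, hcol, hbad⟩ := exists_transport (R := R) (μ := μ') (ν := ν')
    (fun x => measureReal_nonneg) (fun y => measureReal_nonneg)
    (by rw [hμs]; simp) (by rw [hνs]; simp)
    (by linarith : 0 ≤ Δ + η / 2) (half_pos hη) hhall
  obtain ⟨Zt, hZt, hlaw, hjoint⟩ := exists_randomization hZ hU hUu hind ν hc hw0 hrow hcol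
  refine ⟨Zt, hZt, hlaw, ?_⟩
  have hsub : {ω | |Z ω - Zt ω| > r + 2 * d} ⊆
      ⋃ q ∈ Finset.univ.filter (fun q : K × K => ¬ R q.1 q.2),
        {ω | c (Z ω) = q.1 ∧ c (Zt ω) = q.2} := by
    intro ω hω
    refine Set.mem_biUnion (x := (c (Z ω), c (Zt ω))) ?_ ⟨rfl, rfl⟩
    rw [Finset.mem_coe, Finset.mem_filter]
    exact ⟨Finset.mem_univ _, fun hR => not_lt.2 (hRd _ _ hR) hω⟩
  calc _ ≤ ∑ q ∈ Finset.univ.filter (fun q : K × K => ¬ R q.1 q.2),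
        P.real {ω | c (Z ω) = q.1 ∧ c (Zt ω) = q.2} :=
        (measureReal_mono hsub (measure_ne_top _ _)).trans (measureReal_biUnion_finset_le _ _)
    _ ≤ ∑ q ∈ Finset.univ.filter (fun q : K × K => ¬ R q.1 q.2), w q.1 q.2 :=
        Finset.sum_le_sum fun q _ => hjoint _ _
    _ = ∑ x, ∑ y, (if R x y then 0 else w x y) := by
        rw [Finset.sum_filter, Fintype.sum_prod_type]
        simp only [ite_not]
    _ ≤ Δ + η := by linarith

/-- Strassen's theorem on the line with an auxiliary uniform variable, up to an arbitrarily small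
enlargement of the distance and of the probability. -/
theorem exists_coupling {Z U : Ω → ℝ} (hZ : Measurable Z) (hU : Measurable U)
    (hUu : pdf.IsUniform U (Set.Ioo 0 1) P) (hind : IndepFun Z U P) (ν : Measure ℝ)
    [IsProbabilityMeasure ν] {r Δ : ℝ} (hΔ : 0 ≤ Δ)
    (h : ∀ B D : Set ℝ, MeasurableSet B → MeasurableSet D →
      (∀ s ∈ B, ∀ t, |s - t| ≤ r → t ∈ D) → P.real (Z ⁻¹' B) ≤ ν.real D + Δ)
    {d η : ℝ} (hd : 0 < d) (hη : 0 < η) :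
    ∃ Zt : Ω → ℝ, Measurable Zt ∧ P.map Zt = ν ∧
      P.real {ω | |Z ω - Zt ω| > r + 2 * d} ≤ Δ + η := by
  have : IsProbabilityMeasure (P.map Z) := Measure.isProbabilityMeasure_map hZ.aemeasurable
  -- Tightness of the sum of the two laws yields one interval that serves both.
  obtain ⟨M, hM⟩ := exists_measureReal_compl_Icc_le (P.map Z + ν) (half_pos hη)
  obtain ⟨N, hN⟩ := exists_nat_gt ((2 * M + d) / d)
  refine exists_coupling_of_partition hZ hU hUu hind ν hΔ h hη (measurable_gridCell (M + d) d N)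
    (I := {x | 0 < x.1 ∧ x.1 < N})
    (fun s t hst hs => abs_sub_le_of_gridCell_eq hd hst hs.1 hs.2) (le_trans ?_ hM)
  have hsub : (gridCell (M + d) d N ⁻¹' {x | 0 < x.1 ∧ x.1 < N})ᶜ ⊆ (Set.Icc (-M) M)ᶜ :=
    Set.compl_subset_compl.2 fun z hz => gridCell_interior hd hN hz
  rw [measureReal_add_apply, map_measureReal_apply hZ measurableSet_Icc.compl]
  exact add_le_add (measureReal_mono (Set.preimage_mono hsub)) (measureReal_mono hsub)

end Coupling

/-! ### Mean and covariance of the Gaussian sum -/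

section GaussianSum

variable {Ω Ω' : Type*} [MeasurableSpace Ω] [MeasurableSpace Ω'] {P : Measure Ω}
  {P' : Measure Ω'} {n p : ℕ}
  {Y : Fin n → Ω' → EuclideanSpace ℝ (Fin p)}

/-- Needed so that `multivariateGaussian` with this matrix really has it as its covariance. -/
lemma posSemidef_secondMoment {ξ : Ω → EuclideanSpace ℝ (Fin p)}
    (hξ : ∀ j, MemLp (fun ω => ξ ω j) 2 P) : (secondMoment P ξ).PosSemidef := by
  have hint : ∀ j k, Integrable (fun ω => ξ ω j * ξ ω k) P := fun j k =>
    (hξ j).integrable_mul (hξ k)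
  refine Matrix.PosSemidef.of_dotProduct_mulVec_nonneg ?_ fun x => ?_
  · ext j k
    simp [secondMoment, mul_comm]
  · have h : star x ⬝ᵥ (secondMoment P ξ).mulVec x = ∫ ω, (∑ j, x j * ξ ω j) ^ 2 ∂P := by
      have e : ∀ ω, (∑ j, x j * ξ ω j) ^ 2 = ∑ j, ∑ k, x j * (x k * (ξ ω j * ξ ω k)) := by
        intro ω
        rw [sq, Finset.sum_mul_sum]
        exact Finset.sum_congr rfl fun j _ => Finset.sum_congr rfl fun k _ => by ring
      simp only [e]
      rw [integral_finsetSum _ fun j _ => integrable_finsetSum _ fun k _ =>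
        ((hint j k).const_mul (x k)).const_mul (x j)]
      simp only [dotProduct, Matrix.mulVec, star_trivial, secondMoment, Matrix.of_apply]
      refine Finset.sum_congr rfl fun j _ => ?_
      rw [integral_finsetSum _ fun k _ => ((hint j k).const_mul (x k)).const_mul (x j),
        Finset.mul_sum]
      refine Finset.sum_congr rfl fun k _ => ?_
      rw [integral_const_mul, integral_const_mul]
      ring
    rw [h]
    exact integral_nonneg fun ω => sq_nonneg _

variable {S : Fin n → Matrix (Fin p) (Fin p) ℝ}

lemma hasGaussianLaw_sum_of_hasLaw (hind : iIndepFun Y P')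
    (hY : ∀ i, HasLaw (Y i) (multivariateGaussian 0 (S i)) P') :
    HasGaussianLaw (fun ω => ∑ i, Y i ω) P' :=
  hind.hasGaussianLaw_fun_sum fun i => ⟨by rw [(hY i).map_eq]; infer_instance⟩

lemma aemeasurable_sum_of_hasLaw (hY : ∀ i, HasLaw (Y i) (multivariateGaussian 0 (S i)) P') :
    AEMeasurable (fun ω => ∑ i, Y i ω) P' :=
  Finset.aemeasurable_fun_sum _ fun i _ => (hY i).aemeasurable

lemma integral_map_sum_of_hasLaw (hY : ∀ i, HasLaw (Y i) (multivariateGaussian 0 (S i)) P') :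
    ∫ x, x ∂(P'.map fun ω => ∑ i, Y i ω) = 0 := by
  refine (integral_map (aemeasurable_sum_of_hasLaw hY) aestronglyMeasurable_id).trans ?_
  change ∫ ω, ∑ i, Y i ω ∂P' = 0
  rw [integral_finsetSum]
  · refine Finset.sum_eq_zero fun i _ => ?_
    have := (hY i).integral_eq
    rwa [integral_id_multivariateGaussian] at this
  · intro i _
    have h : Integrable id (P'.map (Y i)) := by
      rw [(hY i).map_eq]
      exact IsGaussian.integrable_id
    exact h.comp_aemeasurable (hY i).aemeasurable

lemma integral_coord_mul_map_sum_of_hasLaw [IsProbabilityMeasure P'] (hind : iIndepFun Y P')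
    (hS : ∀ i, (S i).PosSemidef)
    (hY : ∀ i, HasLaw (Y i) (multivariateGaussian 0 (S i)) P') (j k : Fin p) :
    ∫ x, x j * x k ∂(P'.map fun ω => ∑ i, Y i ω) = ∑ i, S i j k := by
  set τ := P'.map fun ω => ∑ i, Y i ω with hτ
  have hg : IsGaussian τ := (hasGaussianLaw_sum_of_hasLaw hind hY).isGaussian_map
  have hlaw : HasLaw (fun ω => ∑ i, Y i ω) τ P' := ⟨aemeasurable_sum_of_hasLaw hY, rfl⟩
  have hcm : ∀ j : Fin p, Measurable fun x : EuclideanSpace ℝ (Fin p) => x j := fun j => by fun_prop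
  have h2 : ∀ i j, MemLp (fun ω => Y i ω j) 2 P' := fun i j => by
    have h := IsGaussian.memLp_two_coord (multivariateGaussian 0 (S i)) j
    rw [← (hY i).map_eq] at h
    exact h.comp_of_map (hY i).aemeasurable
  have e1 : ∫ x, x j * x k ∂τ =
      cov[fun x : EuclideanSpace ℝ (Fin p) => x j, fun x => x k; τ] := by
    rw [covariance_eq_sub (IsGaussian.memLp_two_coord τ j) (IsGaussian.memLp_two_coord τ k),
      IsGaussian.integral_coord (integral_map_sum_of_hasLaw hY), zero_mul, sub_zero]
    rfl
  rw [e1, ← hlaw.covariance_fun_comp (hcm j).aemeasurable (hcm k).aemeasurable]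
  have e2 : ∀ j, (fun ω => (∑ i, Y i ω) j) = fun ω => ∑ i, Y i ω j := fun j => by
    funext ω
    simp
  rw [e2, e2, covariance_fun_sum_fun_sum (fun i => h2 i j) fun i => h2 i k]
  refine Finset.sum_congr rfl fun i _ => ?_
  rw [Finset.sum_eq_single i]
  · rw [(hY i).covariance_fun_comp (hcm j).aemeasurable (hcm k).aemeasurable]
    exact covariance_eval_multivariateGaussian (hS i) j k
  · intro i' _ hi'
    exact ((hind.indepFun hi'.symm).comp (hcm j) (hcm k)).covariance_eq_zero (h2 i j) (h2 i' k)
  · simp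

end GaussianSum

/-! ### The constants, and the comparison of the two laws on sets -/

lemma alpha_pos {β δ : ℝ} (hβ : 0 < β) (hδ : 1 / β < δ) : 0 < alpha β δ := by
  have h1 : 1 < β * δ := by rwa [div_lt_iff₀ hβ, mul_comm] at hδ
  unfold alpha
  nlinarith

lemma eps_pos {β δ : ℝ} (h : 0 < alpha β δ) : 0 < eps β δ :=
  Real.sqrt_pos.2 (mul_pos (Real.exp_pos _) (by linarith))

lemma eps_lt_one {β δ : ℝ} (h : 0 < alpha β δ) : eps β δ < 1 := by
  rw [eps, Real.sqrt_lt' one_pos, one_pow, Real.exp_neg, ← div_eq_inv_mul,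
    div_lt_one (Real.exp_pos _), add_comm]
  exact Real.add_one_lt_exp h.ne'

section Smoothing

variable {Ω : Type*} [MeasurableSpace Ω] {P : Measure Ω} [IsProbabilityMeasure P] {n p : ℕ}
  [NeZero p] {X : Fin n → Ω → EuclideanSpace ℝ (Fin p)} {β δ : ℝ}
  {τ : Measure (EuclideanSpace ℝ (Fin p))} [IsGaussian τ]

lemma measurable_maxSum (hX : ∀ i, Measurable (X i)) : Measurable (maxSum X) :=
  measurable_vecMax.comp (measurable_pi_lambda _ fun j =>
    Finset.measurable_sum _ fun i _ => measurable_coord hX i j)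

lemma B1_nonneg (P : Measure Ω) (X : Fin n → Ω → EuclideanSpace ℝ (Fin p)) : 0 ≤ B1 P X :=
  integral_nonneg fun _ => vecMax_nonneg fun _ => abs_nonneg _

lemma B2_nonneg (P : Measure Ω) (X : Fin n → Ω → EuclideanSpace ℝ (Fin p)) : 0 ≤ B2 P X :=
  integral_nonneg fun _ => vecMax_nonneg fun _ => Finset.sum_nonneg fun _ _ => by positivity

lemma B3_nonneg (P : Measure Ω) (X : Fin n → Ω → EuclideanSpace ℝ (Fin p)) (β : ℝ) :
    0 ≤ B3 P X β :=
  Finset.sum_nonneg fun _ _ => integral_nonneg fun _ => bigCube_nonneg β _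

/-- Comparison of the laws of the two maxima up to an enlargement of the set. -/
theorem measureReal_maxSum_le (hβ : 0 < β) (hδ : 0 < δ) (hX : ∀ i, Measurable (X i))
    (hind : iIndepFun X P) (hmean : ∀ i j, ∫ ω, X i ω j ∂P = 0)
    (h3 : ∀ i j, Integrable (fun ω => |X i ω j| ^ 3) P) (h0 : ∫ x, x ∂τ = 0)
    (hcov : ∀ j k, ∫ x, x j * x k ∂τ = ∑ i, ∫ ω, X i ω j * X i ω k ∂P) {B D : Set ℝ}
    (hB : MeasurableSet B) (hD : MeasurableSet D)
    (hBD : ∀ s ∈ B, ∀ t, |s - t| ≤ 2 * (β⁻¹ * Real.log p) + 2 * β⁻¹ + δ → t ∈ D) :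
    P.real (maxSum X ⁻¹' B) ≤ τ.real {x | vecMax (fun j => x j) ∈ D} +
      144 * β * δ⁻¹ * (B1 P X + β * (B2 P X + B3 P X β)) := by
  have b1 := B1_nonneg P X
  have b2 := B2_nonneg P X
  have b3 := B3_nonneg P X β
  have hδ' := inv_pos.2 hδ
  -- The distance to the empty set is 0 by convention, so the smoothed indicator would not vanish
  -- far away.
  rcases B.eq_empty_or_nonempty with rfl | hne
  · rw [Set.preimage_empty, measureReal_empty]
    positivity
  have hp : (1 : ℝ) ≤ p := by exact_mod_cast NeZero.one_le
  set e := β⁻¹ * Real.log p with he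
  have hF : ∀ x : Fin p → ℝ, vecMax x ≤ lse β x ∧ lse β x ≤ vecMax x + e := fun x => by
    have := lse_le_vecMax_add hβ x
    rw [Fintype.card_fin] at this
    exact ⟨vecMax_le_lse hβ x, this⟩
  have hFi : ∀ x : Fin p → ℝ, |lse β x - vecMax x| ≤ e := fun x => by
    rw [abs_le]
    constructor <;> linarith [(hF x).1, (hF x).2]
  -- The error `e` of the soft maximum is paid twice: the plateau of g absorbs it for the sum, the
  -- enlargement `D` for the Gaussian vector.
  obtain ⟨g, hg1, hg0⟩ := exists_testFun_indicator B (e := e) hβ hδ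
  have hgm : Measurable fun x : Fin p → ℝ => g.toFun (lse β x) :=
    ((continuous_iff_continuousAt.2 fun x => (g.hasDerivAt x).continuousAt).comp
      (continuous_lse β)).measurable
  have hS : Measurable fun ω => g.toFun (lse β fun j => ∑ i, X i ω j) :=
    hgm.comp (measurable_pi_lambda _ fun j =>
      Finset.measurable_sum _ fun i _ => measurable_coord hX i j)
  have hT : Measurable fun x : EuclideanSpace ℝ (Fin p) => g.toFun (lse β fun j => x j) :=
    hgm.comp (measurable_pi_lambda _ fun j => by fun_prop)
  have hbd : ∀ y, ‖g.toFun y‖ ≤ 1 := fun y => by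
    rw [Real.norm_eq_abs, abs_of_nonneg (g.nonneg y)]
    exact g.le_one y
  have hDm : MeasurableSet {x : EuclideanSpace ℝ (Fin p) | vecMax (fun j => x j) ∈ D} :=
    (measurable_vecMax.comp (measurable_pi_lambda _ fun j => by fun_prop)) hD
  have hZm : MeasurableSet (maxSum X ⁻¹' B) := measurable_maxSum hX hB
  have s1 : P.real (maxSum X ⁻¹' B) ≤ ∫ ω, g.toFun (lse β fun j => ∑ i, X i ω j) ∂P := by
    rw [← integral_indicator_one hZm]
    refine integral_mono ((integrable_const (1 : ℝ)).indicator hZm)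
      (Integrable.of_bound hS.aestronglyMeasurable 1 (.of_forall fun ω => hbd _)) fun ω => ?_
    by_cases hω : ω ∈ maxSum X ⁻¹' B
    · refine le_of_eq ?_
      rw [Set.indicator_of_mem hω, hg1]
      · rfl
      · exact (Metric.infDist_le_dist_of_mem (show maxSum X ω ∈ B from hω)).trans (hFi _)
    · rw [Set.indicator_of_notMem hω]
      exact g.nonneg _
  have s2 : ∫ x, g.toFun (lse β fun j => x j) ∂τ ≤ τ.real {x | vecMax (fun j => x j) ∈ D} := by
    rw [← integral_indicator_one hDm]
    refine integral_mono (Integrable.of_bound hT.aestronglyMeasurable 1 (.of_forall fun ω => hbd _))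
      ((integrable_const (1 : ℝ)).indicator hDm) fun x => ?_
    by_cases hx : x ∈ {x : EuclideanSpace ℝ (Fin p) | vecMax (fun j => x j) ∈ D}
    · rw [Set.indicator_of_mem hx]
      exact g.le_one _
    · rw [Set.indicator_of_notMem hx]
      refine (hg0 _ ?_).le
      refine (Metric.le_infDist hne).2 fun s hs => ?_
      have h1 : ¬ |s - vecMax fun j => x j| ≤ 2 * e + 2 * β⁻¹ + δ := fun h => hx (hBD s hs _ h)
      have h2 := hFi fun j => x j
      have h3 := abs_sub_le s (lse β fun j => x j) (vecMax fun j => x j)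
      rw [Real.dist_eq, abs_sub_comm]
      linarith
  have s3 := (abs_le.1 (abs_integral_sub_integral_le hβ hX hind hmean h3 h0 hcov g)).2
  -- Here L = δ⁻¹, and the constant arises as 144 = 24 · 3 · 2 with π/2 ≤ 2.
  have s4 : (24 * δ⁻¹ * β ^ 2 * (3 * B2 P X + B3 P X β) + 5 * δ⁻¹ * β * B1 P X) * (Real.pi / 2) ≤
      144 * β * δ⁻¹ * (B1 P X + β * (B2 P X + B3 P X β)) := by
    have hpi : Real.pi / 2 ≤ 2 := by linarith [Real.pi_le_four]
    calc _ ≤ (72 * δ⁻¹ * β ^ 2 * (B2 P X + B3 P X β) + 72 * δ⁻¹ * β * B1 P X) * 2 := by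
          have t1 : 24 * δ⁻¹ * β ^ 2 * (3 * B2 P X + B3 P X β) ≤
              72 * δ⁻¹ * β ^ 2 * (B2 P X + B3 P X β) := by
            have : 0 ≤ δ⁻¹ * β ^ 2 * B3 P X β := by positivity
            linarith
          have t2 : 5 * δ⁻¹ * β * B1 P X ≤ 72 * δ⁻¹ * β * B1 P X := by
            have : 0 ≤ δ⁻¹ * β * B1 P X := by positivity
            linarith
          exact mul_le_mul (add_le_add t1 t2) hpi (by positivity) (by positivity)
      _ = _ := by ring
  linarith

end Smoothing

end MaxCoupling

/-! ### Assembly -/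

theorem theorem4p1 :
    ∃ C : ℝ, 0 < C ∧
      ∀ {Ω : Type*} {Ω' : Type*} [MeasurableSpace Ω] [MeasurableSpace Ω']
        (P : Measure Ω) [IsProbabilityMeasure P] (P' : Measure Ω') [IsProbabilityMeasure P']
        (n p : ℕ) [NeZero p]
        (X : Fin n → Ω → EuclideanSpace ℝ (Fin p))
        (Y : Fin n → Ω' → EuclideanSpace ℝ (Fin p))
        (U : Ω → ℝ),
        (∀ i, Measurable (X i)) →
        iIndepFun X P →
        (∀ i j, ∫ ω, X i ω j ∂P = 0) →
        (∀ i j, Integrable (fun ω => |X i ω j| ^ 3) P) →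
        -- the probability space carries a uniform variable independent of the sample
        Measurable U →
        pdf.IsUniform U (Set.Ioo 0 1) P →
        IndepFun U (fun ω i => X i ω) P →
        -- the Gaussian vectors, with `Y i ∼ N(0, E[X_i X_iᵀ])`
        iIndepFun Y P' →
        (∀ i, HasLaw (Y i) (multivariateGaussian 0 (MaxCoupling.secondMoment P (X i))) P') →
        ∀ β δ : ℝ, 0 < β → 1 / β < δ →
          0 < MaxCoupling.alpha β δ ∧ MaxCoupling.eps β δ < 1 ∧
          ∃ Zt : Ω → ℝ, Measurable Zt ∧
            IdentDistrib Zt (MaxCoupling.maxSum Y) P P' ∧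
            P.real {ω | |MaxCoupling.maxSum X ω - Zt ω| > 2 * β⁻¹ * Real.log p + 3 * δ} ≤
              (MaxCoupling.eps β δ
                + C * β * δ⁻¹ * (MaxCoupling.B1 P X
                    + β * (MaxCoupling.B2 P X + MaxCoupling.B3 P X β)))
                / (1 - MaxCoupling.eps β δ) := by
  refine ⟨144, by norm_num, ?_⟩
  intro Ω Ω' _ _ P _ P' _ n p _ X Y U hX hind hmean h3 hU hUu hUX hYind hY β δ hβ hβδ
  have hα := MaxCoupling.alpha_pos hβ hβδ
  have hε := MaxCoupling.eps_pos hα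
  have hε1 := MaxCoupling.eps_lt_one hα
  refine ⟨hα, hε1, ?_⟩
  have hβ' : 0 < β⁻¹ := inv_pos.2 hβ
  rw [one_div] at hβδ
  have hδ : 0 < δ := hβ'.trans hβδ
  have hδ' : 0 < δ⁻¹ := inv_pos.2 hδ
  set τ := P'.map fun ω => ∑ i, Y i ω
  have hτ : IsGaussian τ := (MaxCoupling.hasGaussianLaw_sum_of_hasLaw hYind hY).isGaussian_map
  have h0 : ∫ x, x ∂τ = 0 := MaxCoupling.integral_map_sum_of_hasLaw hY
  have hcov : ∀ j k, ∫ x, x j * x k ∂τ = ∑ i, ∫ ω, X i ω j * X i ω k ∂P :=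
    MaxCoupling.integral_coord_mul_map_sum_of_hasLaw hYind
      (fun i => MaxCoupling.posSemidef_secondMoment fun j => MaxCoupling.memLp_two_coord hX h3 i j) hY
  have hvm : Measurable fun x : EuclideanSpace ℝ (Fin p) => MaxCoupling.vecMax fun j => x j :=
    MaxCoupling.measurable_vecMax.comp (measurable_pi_lambda _ fun j => by fun_prop)
  set ν := τ.map fun x => MaxCoupling.vecMax fun j => x j with hν
  have hνp : IsProbabilityMeasure ν := Measure.isProbabilityMeasure_map hvm.aemeasurable
  have hTm : AEMeasurable (fun ω => ∑ i, Y i ω) P' := MaxCoupling.aemeasurable_sum_of_hasLaw hY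
  have hmax : MaxCoupling.maxSum Y = (fun x : EuclideanSpace ℝ (Fin p) =>
      MaxCoupling.vecMax fun j => x j) ∘ fun ω => ∑ i, Y i ω := by
    funext ω
    simp [MaxCoupling.maxSum]
  have hνY : P'.map (MaxCoupling.maxSum Y) = ν := by
    rw [hmax, hν, AEMeasurable.map_map_of_aemeasurable hvm.aemeasurable hTm]
  have hZm := MaxCoupling.measurable_maxSum hX
  have hZU : IndepFun (MaxCoupling.maxSum X) U P := by
    have hm : Measurable fun x : Fin n → EuclideanSpace ℝ (Fin p) =>
        MaxCoupling.vecMax fun j => ∑ i, x i j :=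
      MaxCoupling.measurable_vecMax.comp (measurable_pi_lambda _ fun j => by fun_prop)
    exact (hUX.comp measurable_id hm).symm
  set Δ := 144 * β * δ⁻¹ * (MaxCoupling.B1 P X
    + β * (MaxCoupling.B2 P X + MaxCoupling.B3 P X β))
  have hΔ : 0 ≤ Δ := by
    have := MaxCoupling.B1_nonneg P X
    have := MaxCoupling.B2_nonneg P X
    have := MaxCoupling.B3_nonneg P X β
    positivity
  -- The mesh is d = δ - β⁻¹, so that r + 2d is exactly 2β⁻¹ log p + 3δ, and the probability loss is
  -- η = ε.
  obtain ⟨Zt, hZt, hlaw, hbound⟩ := MaxCoupling.exists_coupling hZm hU hUu hZU ν hΔ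
    (r := 2 * (β⁻¹ * Real.log p) + 2 * β⁻¹ + δ)
    (fun B D hB hD hBD => by
      rw [hν, map_measureReal_apply hvm hD]
      exact MaxCoupling.measureReal_maxSum_le hβ hδ hX hind hmean h3 h0 hcov hB hD hBD)
    (sub_pos.2 hβδ) hε
  refine ⟨Zt, hZt, ⟨hZt.aemeasurable, ?_, hlaw.trans hνY.symm⟩, ?_⟩
  · rw [hmax]
    exact hvm.comp_aemeasurable hTm
  · rw [show 2 * (β⁻¹ * Real.log p) + 2 * β⁻¹ + δ + 2 * (δ - β⁻¹) =
      2 * β⁻¹ * Real.log p + 3 * δ by ring] at hbound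
    refine hbound.trans ?_
    -- The bound Δ + ε is already stronger than required; dividing by 1 - ε ∈ (0, 1) only enlarges
    -- it.
    rw [le_div_iff₀ (sub_pos.2 hε1), add_comm]
    exact mul_le_of_le_one_right (by positivity) (by linarith)
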